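/- Let $n\in\mathbb N$, $f=xy-z^{n+1}\in\mathbb C[x,y,z]$ and $X=V(f)\subset\mathbb C^3$ (the $A_n$-singularity, for $n\ge 1$). *Profiles.* For $v\in\mathbb R_{\ge0}^3$ let $In_v(f)$ be the sum of the terms $c_\alpha x^\alpha$ of $f$ for which $v\cdot\alpha$ is minimal on $\mathrm{supp}(f)$. The Gröbner cone of $v$ is the closure of $\{w\in\mathbb R_{\ge 0}^3 : In_w(f)=In_v(f)\}$. The profile of a cone is the convex hull of its extremal vectors, i.e. of the primitive integral vectors on its one-dimensional faces. Let $P\subset\mathbb Z^3$ be the set of lattice points lying in the profile of some three-dimensional Gröbner cone. A vector $v\in P$ is identified with the monomial valuation $\nu_v(h)=\min\{v\cdot\alpha : \alpha\in \mathrm{supp}(h)\}$ on $\mathbb C[x,y,z]$. *Embedded valuations.* Let $B\subset\mathbb C^3$ be closed. For $m\ge 0$ let $X_m^B$ be the space of $m$-jets $\mathrm{Spec}\,\mathbb C[t]/(t^{m+1})\to X$ with base point in $B$. For an irreducible component $C$ of $X_m^B$ let $S_C$ be the set of arcs $\gamma\in\mathbb C[[t]]^3$ whose truncation at order $m$ lies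 in $C$, and put $\nu_C(h)=\min_{\gamma\in S_C}\mathrm{ord}_t\, h(\gamma(t))$ and $v(C)=(\nu_C(x),\nu_C(y),\nu_C(z))$. Say that $C$ satisfies the contact condition if $\mathrm{ord}_t f(\gamma(t))=m+1$ for some $\gamma\in S_C$. The component $C$ is essential if it satisfies the contact condition and, when $m\ge 1$, $v(C)\ne v(C')$ for every irreducible component $C'$ of $X_{m-1}^B$ that satisfies the contact condition and contains the truncation of $C$. Let $EV_B(X)$ be the set of the valuations $\nu_C$ of the essential components $C$ of $X^B_m$, $m\ge0$. *Claim.* 1. Taking the jets of $X$ over the coordinate hyperplanes, together with the three coordinate valuations $\nu_{e_1},\nu_{e_2},\nu_{e_3}$ (the orders of vanishing along the coordinate hyperplanes), one has $$\{\nu_v : v\in P\}=EV_{\{xyz=0\}}(X)\,\cup\,\{\nu_{e_1},\nu_{e_2},\nu_{e_3}\}.$$ 2. Taking the jets of $X$ over the singular locus, one obtains exactly the vectors of $P$ with positive coordinates (those for which the centre of $\nu_v$ is the origin): $$\{\nu_v : v\in P,\ v_1,v_2,v_3>0\}=EV_{\mathrm{Sing}(X)}(X).$$ -/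

import Mathlib

/-! ### Gröbner fan of a hypersurface -/

section GroebnerFan

variable {ι : Type*} [Fintype ι]

/-- The weight `v · α` of an exponent `α`. -/
def expWeight (v : ι → ℝ) (α : ι →₀ ℕ) : ℝ := ∑ i, v i * (α i : ℝ)

open Classical in
/-- The `v`-initial form of `f`: the sum of the terms of `f` whose exponent has minimal
`v`-weight among the exponents in the support of `f`. -/
noncomputable def initialForm (v : ι → ℝ) (f : MvPolynomial ι ℂ) : MvPolynomial ι ℂ :=
  ∑ α ∈ f.support with (∀ β ∈ f.support, expWeight v α ≤ expWeight v β),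
    MvPolynomial.monomial α (f.coeff α)

/-- The Gröbner cone of `v`: the closure of the set of nonnegative `w` with the same
initial form. -/
def groebnerCone (f : MvPolynomial ι ℂ) (v : ι → ℝ) : Set (ι → ℝ) :=
  closure {w | 0 ≤ w ∧ initialForm w f = initialForm v f}

/-- The Gröbner cones of full dimension. -/
def maximalGroebnerCones (f : MvPolynomial ι ℂ) : Set (Set (ι → ℝ)) :=
  {C | ∃ v : ι → ℝ, 0 ≤ v ∧ C = groebnerCone f v ∧ Submodule.span ℝ C = ⊤}

/-! ### Profiles -/

/-- The extremal vectors of a cone `C`: the primitive integral vectors that span a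
one-dimensional face (extremal ray) of `C`. -/
def extremalVectors (C : Set (ι → ℝ)) : Set (ι → ℤ) :=
  {v | (∀ d : ℤ, (∀ i, d ∣ v i) → IsUnit d) ∧
    IsExtreme ℝ C {x | ∃ r : ℝ, 0 ≤ r ∧ x = r • (fun i => (v i : ℝ))}}

/-- The profile of a cone: the convex hull of its extremal vectors. -/
def coneProfile (C : Set (ι → ℝ)) : Set (ι → ℝ) :=
  convexHull ℝ ((fun v : ι → ℤ => fun i => (v i : ℝ)) '' extremalVectors C)

/-- The lattice points in the profiles of the full-dimensional Gröbner cones of `V(f)`. -/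
def profileLatticePoints (f : MvPolynomial ι ℂ) : Set (ι → ℤ) :=
  {v | ∃ C ∈ maximalGroebnerCones f, (fun i => (v i : ℝ)) ∈ coneProfile C}

/-- Lattice points of the profiles have nonnegative coordinates. -/
theorem profileLatticePoints_nonneg (f : MvPolynomial ι ℂ) {v : ι → ℤ}
    (hv : v ∈ profileLatticePoints f) : 0 ≤ v := by
  obtain ⟨C, ⟨w, -, rfl, -⟩, hv⟩ := hv
  have hC : groebnerCone f w ⊆ Set.Ici 0 :=
    closure_minimal (fun x hx => hx.1) isClosed_Ici
  have hP : coneProfile (groebnerCone f w) ⊆ Set.Ici 0 := by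
    refine convexHull_min ?_ (convex_Ici (𝕜 := ℝ) 0)
    rintro _ ⟨u, hu, rfl⟩
    exact hC (hu.2.subset ⟨1, zero_le_one, (one_smul ℝ _).symm⟩)
  intro i
  have h := hP hv i
  simpa using h

end GroebnerFan

/-! ### Jet schemes and embedded valuations -/

section Jets

variable {ι : Type*} [Fintype ι]

/-- The monomial valuation with weights `v` (for `v` with nonnegative coordinates): the minimum
of `v · α` over the exponents `α` of `h`, with value `⊤` at `h = 0`. -/
noncomputable def monomialValuation (v : ι → ℤ) (h : MvPolynomial ι ℂ) : ℕ∞ :=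
  ⨅ α ∈ h.support, ((∑ i, (v i).toNat * α i : ℕ) : ℕ∞)

/-- The coordinate ring of the space of `m`-jets of affine space: the variable `(i, j)` is the
coefficient of `t ^ j` in the `i`-th coordinate. -/
abbrev JetRing (ι : Type*) (m : ℕ) : Type _ := MvPolynomial (ι × Fin (m + 1)) ℂ

/-- The `i`-th coordinate of the universal `m`-jet. -/
noncomputable def universalJet (m : ℕ) (i : ι) : Polynomial (JetRing ι m) :=
  ∑ j : Fin (m + 1), Polynomial.monomial (j : ℕ) (MvPolynomial.X (i, j))

/-- The ideal of the `m`-th jet scheme of `V(f)`: generated by the coefficients of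
`1, t, …, t ^ m` in `f(universal jet)`. -/
noncomputable def jetIdeal (f : MvPolynomial ι ℂ) (m : ℕ) : Ideal (JetRing ι m) :=
  Ideal.span (Set.range fun k : Fin (m + 1) =>
    (MvPolynomial.aeval (universalJet m) f).coeff (k : ℕ))

/-- The ideal of the `m`-jets of `V(f)` whose base point lies in the closed set `V(B)`. -/
noncomputable def jetIdealOver (f : MvPolynomial ι ℂ) (B : Ideal (MvPolynomial ι ℂ)) (m : ℕ) :
    Ideal (JetRing ι m) :=
  jetIdeal f m ⊔
    B.map (MvPolynomial.rename (R := ℂ) fun i : ι => (i, (0 : Fin (m + 1)))).toRingHom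

/-- For an ideal `P` of the ring of `m`-jets of affine space, the cylinder of all arcs of affine
space whose truncation at order `m` lies in `V(P)`. -/
def jetCylinder {m : ℕ} (P : Ideal (JetRing ι m)) : Set (ι → PowerSeries ℂ) :=
  {γ | ∀ g ∈ P, MvPolynomial.eval (fun p => PowerSeries.coeff (p.2 : ℕ) (γ p.1)) g = 0}

/-- The inverse images, in the arc space of affine space, of the irreducible components of the
space of `m`-jets of `V(f)` over `V(B)`. The components are given by the minimal primes of the
defining ideal. -/
def jetComponentCylinders (f : MvPolynomial ι ℂ) (B : Ideal (MvPolynomial ι ℂ)) (m : ℕ) :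
    Set (Set (ι → PowerSeries ℂ)) :=
  jetCylinder '' (jetIdealOver f B m).minimalPrimes

/-- The order of `h` along an arc. -/
noncomputable def arcOrder (γ : ι → PowerSeries ℂ) (h : MvPolynomial ι ℂ) : ℕ∞ :=
  (MvPolynomial.aeval γ h).order

/-- The valuation attached to a set of arcs: the generic, i.e. minimal, order of `h`. -/
noncomputable def cylinderValuation (S : Set (ι → PowerSeries ℂ)) (h : MvPolynomial ι ℂ) : ℕ∞ :=
  ⨅ γ ∈ S, arcOrder γ h

/-- The weight vector of a set of arcs: the generic orders of the coordinates. -/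
noncomputable def weightVector (S : Set (ι → PowerSeries ℂ)) (i : ι) : ℕ∞ :=
  cylinderValuation S (MvPolynomial.X i)

/-- `S` is the cylinder of an irreducible component `C` of the `m`-jets of `V(f)` over `V(B)` such
that some arc in `S` has contact order exactly `m + 1` with `V(f)`. -/
def IsContactCylinder (f : MvPolynomial ι ℂ) (B : Ideal (MvPolynomial ι ℂ)) (m : ℕ)
    (S : Set (ι → PowerSeries ℂ)) : Prop :=
  S ∈ jetComponentCylinders f B m ∧ ∃ γ ∈ S, arcOrder γ f = ((m + 1 : ℕ) : ℕ∞)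

/-- `S` is the cylinder of an essential component of the `m`-jets over `V(B)`: the contact
condition holds, and the weight vector is new, i.e. differs from that of every component of the
`(m - 1)`-jets satisfying the contact condition into which the component is truncated. -/
def IsEssentialCylinder (f : MvPolynomial ι ℂ) (B : Ideal (MvPolynomial ι ℂ)) (m : ℕ)
    (S : Set (ι → PowerSeries ℂ)) : Prop :=
  IsContactCylinder f B m S ∧
    ∀ (k : ℕ) (T : Set (ι → PowerSeries ℂ)), k + 1 = m → IsContactCylinder f B k T → S ⊆ T →
      weightVector S ≠ weightVector T

/-- The embedded valuations of `V(f)` over the closed set `V(f) ∩ V(B)`. -/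
def embeddedValuations (f : MvPolynomial ι ℂ) (B : Ideal (MvPolynomial ι ℂ)) :
    Set (MvPolynomial ι ℂ → ℕ∞) :=
  {ν | ∃ (m : ℕ) (S : Set (ι → PowerSeries ℂ)), IsEssentialCylinder f B m S ∧
    ν = cylinderValuation S}

/-- The Jacobian ideal `(f, ∂f/∂xᵢ)`, which defines the singular locus of `V(f)`. -/
noncomputable def singularIdeal (f : MvPolynomial ι ℂ) : Ideal (MvPolynomial ι ℂ) :=
  Ideal.span (insert f (Set.range fun i => MvPolynomial.pderiv i f))

/-- The ideal of the union of the coordinate hyperplanes. -/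
noncomputable def coordHyperplanesIdeal (ι : Type*) [Fintype ι] : Ideal (MvPolynomial ι ℂ) :=
  Ideal.span {∏ i, MvPolynomial.X i}

end Jets

/-- The equation `x y - z ^ (n + 1)` of the `A_n`-singularity. -/
noncomputable def singularityA (n : ℕ) : MvPolynomial (Fin 3) ℂ :=
  MvPolynomial.X 0 * MvPolynomial.X 1 - MvPolynomial.X 2 ^ (n + 1)

/-!
The proof computes both sides. Write `N = n + 1`.

*Profiles.* There are two maximal Gröbner cones, cut out in the positive octant by `N z ≤ x + y` and
by `x + y ≤ N z`. Their extremal vectors are `e₁, e₂, (N, 0, 1), (0, N, 1)` and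
`e₃, (N, 0, 1), (0, N, 1)`, so the lattice points of the profiles are `e₁`, `e₂` and all `(a, b, 1)`
with `a + b ≤ N` (`mem_profileLatticePoints_singularityA`).

*Jets.* The key is the parametrization (`paramArc`)
`x = t ^ a R`, `y = t ^ (N - a) R ^ n S ^ N + t ^ (m + 1 - a) Q`, `z = t R S`
with arbitrary power series `R, S, Q`: it satisfies `x y - z ^ N = t ^ (m + 1) R Q` identically. The
closure of the set of its `m`-jets is irreducible, being defined by the kernel `paramIdeal` of a ring
homomorphism to a polynomial ring. The generic orders are `(a, min N (m + 1) - a, 1)`, and the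
generic contact order is `m + 1`.

These closures are all the components: let an arc have contact order at
least `m + 1` and coordinates of orders at least `(a, b, 1)`, where `a + b = min N (m + 1)`. If the
order of `x` is exactly `a`, the arc is in the image of the parametrization. In general it is a
limit of such arcs (`mem_jetCylinder_paramIdeal`): with `x = t ^ a u`, `y = t ^ b v` and `z = t w`,
take `u`, `v` monic polynomials, move `w` and the remainder `(x y - z ^ N) / t ^ (m + 1)` in a
one-parameter family, and follow the factorization `u v` along the induced deformation. This is
possible over an integral extension of `ℂ[s]` over which the deformed product splits into linear
factors (`exists_factorization_deformation`). The deformed `u` has nonzero constant term, since the deformed product has.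

Over the coordinate hyperplanes the components at level `m` are therefore indexed by `a + b =
min N (m + 1)` with `a, b ≥ 0`, and over the singular point by the same equation with `a, b ≥ 1`
(`IsStandardBase.minimalPrimes_eq`); the one exception is the point of `0`-jets over the origin,
which violates the contact condition. For `m < N` the orders `(a, b, 1)` have sum `m + 2`, so each of
these components is essential; its cylinder is given by the inequalities on the orders alone, and its
valuation is monomial. For `m ≥ N` the component with index `a` is truncated into the component with
the same index and the same orders, so it is not essential.
-/

/-! ### Deforming a factorization -/

section Deformation

open Polynomial

theorem Multiset.exists_add_of_map_eq_add {α β : Type*} {f : α → β} {s : Multiset α}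
    {a b : Multiset β} (h : s.map f = a + b) :
    ∃ s₁ s₂, s = s₁ + s₂ ∧ s₁.map f = a ∧ s₂.map f = b := by
  classical
  induction a using Multiset.induction generalizing s with
  | empty => exact ⟨0, s, by simp, by simp, by simpa using h⟩
  | cons x a ih =>
    have hx : x ∈ s.map f := by simp [h]
    obtain ⟨y, hy, rfl⟩ := Multiset.mem_map.1 hx
    obtain ⟨s', rfl⟩ := Multiset.exists_cons_of_mem hy
    obtain ⟨s₁, s₂, rfl, rfl, rfl⟩ := ih (s := s') (by simpa using h)
    exact ⟨y ::ₘ s₁, s₂, by simp, by simp, rfl⟩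

/-- A ring that is integral over `ℂ[X]` has a point over the origin of the affine line. -/
theorem exists_algHom_apply_algebraMap_X_eq_zero (A : Type*) [CommRing A] [IsDomain A]
    [Algebra ℂ A] [Algebra ℂ[X] A] [IsScalarTower ℂ ℂ[X] A] [Algebra.IsIntegral ℂ[X] A]
    (hinj : Function.Injective (algebraMap ℂ[X] A)) :
    ∃ π : A →ₐ[ℂ] ℂ, π (algebraMap ℂ[X] A X) = 0 := by
  have hmax : (RingHom.ker (evalRingHom (0 : ℂ))).IsMaximal :=
    RingHom.ker_isMaximal_of_surjective _ fun c => ⟨C c, by simp⟩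
  obtain ⟨Q, hQ, hcomap⟩ := Ideal.exists_ideal_over_maximal_of_isIntegral
    (S := A) (RingHom.ker (evalRingHom (0 : ℂ)))
    (by rw [(RingHom.injective_iff_ker_eq_bot _).1 hinj]; exact bot_le)
  have hmem (p : ℂ[X]) : algebraMap ℂ[X] A p ∈ Q ↔ p.eval 0 = 0 := by
    rw [← Ideal.mem_comap, hcomap, RingHom.mem_ker, coe_evalRingHom]
  let : Field (A ⧸ Q) := Ideal.Quotient.field Q
  have hint : Algebra.IsIntegral ℂ (A ⧸ Q) := by
    refine ⟨fun x => ?_⟩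
    obtain ⟨a, rfl⟩ := Ideal.Quotient.mk_surjective x
    obtain ⟨p, hp, hpa⟩ := Algebra.IsIntegral.isIntegral (R := ℂ[X]) a
    refine ⟨p.map (evalRingHom 0), hp.map _, ?_⟩
    rw [eval₂_map]
    have hcomp : (algebraMap ℂ (A ⧸ Q)).comp (evalRingHom 0) =
        (Ideal.Quotient.mk Q).comp (algebraMap ℂ[X] A) := by
      refine RingHom.ext fun q => ?_
      have h1 : algebraMap ℂ[X] A (q - C (q.eval 0)) ∈ Q := by rw [hmem]; simp
      rw [map_sub, ← Ideal.Quotient.eq] at h1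
      simp only [RingHom.comp_apply, h1, coe_evalRingHom]
      rw [← algebraMap_eq, ← IsScalarTower.algebraMap_apply]
      rfl
    rw [hcomp, ← hom_eval₂, hpa, map_zero]
  let e : ℂ ≃ₐ[ℂ] (A ⧸ Q) := AlgEquiv.ofBijective (Algebra.ofId ℂ (A ⧸ Q))
    IsAlgClosed.algebraMap_bijective_of_isIntegral
  refine ⟨e.symm.toAlgHom.comp (Ideal.Quotient.mkₐ ℂ Q), ?_⟩
  have : Ideal.Quotient.mk Q (algebraMap ℂ[X] A X) = 0 :=
    Ideal.Quotient.eq_zero_iff_mem.2 ((hmem X).2 (by simp))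
  simp [this]

/-- A factorization of a monic polynomial extends to any monic one-parameter deformation `H` of
the product, once the parameter is allowed to run over an integral cover of the line: split
`H` completely over an integral extension `A` of `ℂ[s]`, and group its roots according to the
factor whose root they specialize to at `s = 0`. -/
theorem exists_factorization_deformation {u v : ℂ[X]} (hu : u.Monic) (hv : v.Monic)
    {H : ℂ[X][X]} (hH : H.Monic) (h0 : H.map (evalRingHom 0) = u * v) :
    ∃ (A : Type) (_ : CommRing A) (_ : IsDomain A) (_ : Algebra ℂ A) (s : A) (π : A →ₐ[ℂ] ℂ)
      (U V : A[X]), Function.Injective (aeval (R := ℂ) s) ∧ π s = 0 ∧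
      U * V = H.map (aeval (R := ℂ) s).toRingHom ∧
      U.map π.toRingHom = u ∧ V.map π.toRingHom = v := by
  let K := AlgebraicClosure (FractionRing ℂ[X])
  let A := integralClosure ℂ[X] K
  have hinjK : Function.Injective (algebraMap ℂ[X] K) := by
    rw [IsScalarTower.algebraMap_eq ℂ[X] (FractionRing ℂ[X]) K]
    exact (algebraMap (FractionRing ℂ[X]) K).injective.comp
      (IsFractionRing.injective ℂ[X] (FractionRing ℂ[X]))
  have hinj : Function.Injective (algebraMap ℂ[X] A) := by
    rw [IsScalarTower.algebraMap_eq ℂ[X] A K, RingHom.coe_comp] at hinjK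
    exact Function.Injective.of_comp hinjK
  obtain ⟨π, hπ⟩ := exists_algHom_apply_algebraMap_X_eq_zero A hinj
  have haeval : (aeval (R := ℂ) (algebraMap ℂ[X] A X)).toRingHom = algebraMap ℂ[X] A := by
    have : aeval (R := ℂ) (algebraMap ℂ[X] A X) = IsScalarTower.toAlgHom ℂ ℂ[X] A :=
      Polynomial.algHom_ext (by simp)
    rw [this]; rfl
  have hπc : π.toRingHom.comp (algebraMap ℂ[X] A) = evalRingHom 0 := by
    rw [← haeval]
    refine Polynomial.ringHom_ext (fun c => ?_) ?_
    · simp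
    · simp [hπ]
  obtain ⟨ρ, hρ⟩ : ∃ ρ : Multiset A, (ρ.map fun a => X - C a).prod = H.map (algebraMap ℂ[X] A) := by
    have hsp := (IsAlgClosed.splits (H.map (algebraMap ℂ[X] K))).eq_prod_roots_of_monic (hH.map _)
    obtain ⟨ρ, hρ⟩ : ∃ ρ : Multiset A, ρ.map Subtype.val = (H.map (algebraMap ℂ[X] K)).roots := by
      refine (Multiset.canLift Subtype.val (fun x => x ∈ A)).prf _ fun x hx => ?_
      refine ⟨H, hH, ?_⟩
      have := (mem_roots'.1 hx).2
      rwa [IsRoot.def, eval_map] at this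
    refine ⟨ρ, Polynomial.map_injective (algebraMap A K) Subtype.val_injective ?_⟩
    rw [map_map, ← IsScalarTower.algebraMap_eq, hsp, ← hρ, Polynomial.map_multiset_prod,
      Multiset.map_map, Multiset.map_map]
    congr 1
    refine Multiset.map_congr rfl fun a _ => ?_
    simp only [Function.comp_apply, Polynomial.map_sub, map_X, map_C]
    rfl
  have hroots : ρ.map π = u.roots + v.roots := by
    rw [← roots_mul (mul_ne_zero hu.ne_zero hv.ne_zero), ← h0, ← hπc, ← map_map, ← hρ,
      Polynomial.map_multiset_prod, Multiset.map_map]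
    have : (ρ.map (Polynomial.map π.toRingHom ∘ fun a => X - C a)) =
        (ρ.map π).map fun a => X - C a := by
      rw [Multiset.map_map]
      exact Multiset.map_congr rfl fun a _ => by simp
    rw [this, roots_multiset_prod_X_sub_C]
  obtain ⟨ρ₁, ρ₂, rfl, h₁, h₂⟩ := Multiset.exists_add_of_map_eq_add hroots
  have key (w : ℂ[X]) (hw : w.Monic) (σ : Multiset A) (h : σ.map π = w.roots) :
      ((σ.map fun a => X - C a).prod).map π.toRingHom = w := by
    rw [(IsAlgClosed.splits w).eq_prod_roots_of_monic hw, ← h, Polynomial.map_multiset_prod,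
      Multiset.map_map, Multiset.map_map]
    congr 1
    exact Multiset.map_congr rfl fun a _ => by simp
  refine ⟨A, inferInstance, inferInstance, inferInstance, algebraMap ℂ[X] A X, π,
    (ρ₁.map fun a => X - C a).prod, (ρ₂.map fun a => X - C a).prod, ?_, hπ, ?_,
    key u hu ρ₁ h₁, key v hv ρ₂ h₂⟩
  · intro p q hpq
    refine hinj ?_
    rw [← haeval]
    exact hpq
  · rw [haeval, ← hρ, Multiset.map_add, Multiset.prod_add]

end Deformation

/-! ### Arcs and their jets -/

section ArcJets

open MvPolynomial

variable {ι : Type*} {B B' : Type*} [CommRing B] [CommRing B']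

/-- The coordinates of the `m`-jet of an arc `γ` with coefficients in a ring `B`: the point of the
affine space with coordinate ring `JetRing ι m` obtained by truncating `γ`. -/
noncomputable def jetPoint (m : ℕ) (γ : ι → PowerSeries B) : ι × Fin (m + 1) → B :=
  fun p => PowerSeries.coeff (p.2 : ℕ) (γ p.1)

theorem jetPoint_congr {m : ℕ} {γ δ : ι → PowerSeries B}
    (h : ∀ i, PowerSeries.X ^ (m + 1) ∣ γ i - δ i) : jetPoint m γ = jetPoint m δ := by
  funext p
  have := PowerSeries.X_pow_dvd_iff.1 (h p.1) p.2 p.2.2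
  rwa [map_sub, sub_eq_zero] at this

theorem X_pow_dvd_trunc_sub (k : ℕ) (φ : PowerSeries B) :
    PowerSeries.X ^ k ∣ (PowerSeries.trunc k φ : PowerSeries B) - φ := by
  rw [PowerSeries.X_pow_dvd_iff]
  intro j hj
  simp [PowerSeries.coeff_trunc, hj]

variable [Algebra ℂ B] [Algebra ℂ B']

theorem map_aeval_jetPoint (φ : B →ₐ[ℂ] B') (m : ℕ) (γ : ι → PowerSeries B) (g : JetRing ι m) :
    φ (aeval (jetPoint m γ) g) =
      aeval (jetPoint m fun i => PowerSeries.map φ.toRingHom (γ i)) g := by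
  rw [comp_aeval_apply]
  congr 2

theorem mem_jetCylinder_iff {m : ℕ} {P : Ideal (JetRing ι m)} {γ : ι → PowerSeries ℂ} :
    γ ∈ jetCylinder P ↔ ∀ g ∈ P, aeval (jetPoint m γ) g = 0 :=
  Iff.rfl

theorem jetCylinder_anti {m : ℕ} {P P' : Ideal (JetRing ι m)} (h : P ≤ P') :
    jetCylinder P' ⊆ jetCylinder P := fun _ hγ g hg => hγ g (h hg)

theorem mem_jetCylinder_iff_le_ker {m : ℕ} {P : Ideal (JetRing ι m)} {γ : ι → PowerSeries ℂ} :
    γ ∈ jetCylinder P ↔ P ≤ RingHom.ker (aeval (R := ℂ) (jetPoint m γ)) :=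
  Iff.rfl

theorem dvd_aeval_sub_aeval {d : B} {x y : ι → B} (h : ∀ i, d ∣ x i - y i)
    (f : MvPolynomial ι ℂ) : d ∣ aeval x f - aeval y f := by
  rw [← Ideal.mem_span_singleton, ← Ideal.Quotient.eq, ← Ideal.Quotient.mkₐ_eq_mk ℂ,
    comp_aeval_apply, comp_aeval_apply]
  congr 2
  funext i
  exact Ideal.Quotient.eq.2 (Ideal.mem_span_singleton.2 (h i))

theorem map_universalJet (m : ℕ) (γ : ι → PowerSeries ℂ) (i : ι) :
    (universalJet m i).map (aeval (R := ℂ) (jetPoint m γ)).toRingHom =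
      PowerSeries.trunc (m + 1) (γ i) := by
  ext k
  rw [universalJet, Polynomial.map_sum, Polynomial.finsetSum_coeff, PowerSeries.coeff_trunc]
  simp only [Polynomial.map_monomial, Polynomial.coeff_monomial]
  split_ifs with hk
  · rw [Finset.sum_eq_single ⟨k, hk⟩ (fun j _ hj => if_neg fun h => hj (Fin.ext h)) (by simp)]
    simp [jetPoint]
  · exact Finset.sum_eq_zero fun j _ => if_neg (by omega)

theorem aeval_jetPoint_coeff (f : MvPolynomial ι ℂ) (m : ℕ) (γ : ι → PowerSeries ℂ) {k : ℕ}
    (hk : k < m + 1) :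
    aeval (jetPoint m γ) ((aeval (universalJet m) f).coeff k) =
      PowerSeries.coeff k (aeval γ f) := by
  have h1 : aeval (jetPoint m γ) ((aeval (universalJet m) f).coeff k) =
      (aeval (fun i => PowerSeries.trunc (m + 1) (γ i)) f : Polynomial ℂ).coeff k := by
    have := comp_aeval_apply (R := ℂ) (f := universalJet m)
      (Polynomial.mapAlgHom (aeval (R := ℂ) (jetPoint m γ))) f
    have h2 : (fun i => Polynomial.mapAlgHom (aeval (R := ℂ) (jetPoint m γ)) (universalJet m i)) =
        fun i => PowerSeries.trunc (m + 1) (γ i) := funext fun i => map_universalJet m γ i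
    rw [h2] at this
    rw [← this]
    simp
  have h3 : ((aeval (fun i => PowerSeries.trunc (m + 1) (γ i)) f : Polynomial ℂ) : PowerSeries ℂ)
      = aeval (fun i => (PowerSeries.trunc (m + 1) (γ i) : PowerSeries ℂ)) f :=
    comp_aeval_apply (R := ℂ) _ (Polynomial.coeToPowerSeries.algHom ℂ) f
  rw [h1, ← Polynomial.coeff_coe, h3]
  have h4 := PowerSeries.X_pow_dvd_iff.1
    (dvd_aeval_sub_aeval (fun i => X_pow_dvd_trunc_sub (m + 1) (γ i)) f) k hk
  rwa [map_sub, sub_eq_zero] at h4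

/-- An arc has its `m`-jet on `V(f)` over `V(B)` if and only if `f` vanishes to order at least
`m + 1` along it and its base point lies in `V(B)`. -/
theorem mem_jetCylinder_jetIdealOver [Fintype ι] {f : MvPolynomial ι ℂ}
    {I : Ideal (MvPolynomial ι ℂ)} {m : ℕ} {γ : ι → PowerSeries ℂ} :
    γ ∈ jetCylinder (jetIdealOver f I m) ↔ PowerSeries.X ^ (m + 1) ∣ aeval γ f ∧
      I ≤ RingHom.ker (aeval (R := ℂ) fun i => PowerSeries.constantCoeff (γ i)) := by
  rw [mem_jetCylinder_iff_le_ker, jetIdealOver, sup_le_iff, jetIdeal, Ideal.span_le,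
    Ideal.map_le_iff_le_comap, PowerSeries.X_pow_dvd_iff]
  refine and_congr ⟨?_, ?_⟩ ?_
  · intro h k hk
    have := h ⟨⟨k, hk⟩, rfl⟩
    rwa [SetLike.mem_coe, RingHom.mem_ker, aeval_jetPoint_coeff f m γ hk] at this
  · rintro h _ ⟨k, rfl⟩
    rw [SetLike.mem_coe, RingHom.mem_ker, aeval_jetPoint_coeff f m γ k.2]
    exact h k k.2
  · refine Iff.of_eq (congrArg (I ≤ ·) (Ideal.ext fun g => ?_))
    simp only [Ideal.mem_comap, RingHom.mem_ker, AlgHom.toRingHom_eq_coe, RingHom.coe_coe,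
      aeval_rename]
    refine Eq.congr (congrArg (fun x => aeval x g) ?_) rfl
    funext i
    simp [jetPoint]

end ArcJets

/-! ### Parametrized components of the jet spaces of the `A_n`-singularity -/

section Parametrization

open MvPolynomial

variable {B B' : Type*} [CommRing B] [CommRing B']

/-- A parametrization of arcs whose contact order with `x y = z ^ (n + 1)` is at least `m + 1`:
along this arc `x y - z ^ (n + 1)` equals `t ^ (m + 1) * R * Q`. -/
noncomputable def paramArc (n m a : ℕ) (R S Q : PowerSeries B) : Fin 3 → PowerSeries B :=
  ![PowerSeries.X ^ a * R,
    PowerSeries.X ^ (n + 1 - a) * (R ^ n * S ^ (n + 1)) + PowerSeries.X ^ (m + 1 - a) * Q,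
    PowerSeries.X * (R * S)]

theorem map_paramArc (φ : B →+* B') (n m a : ℕ) (R S Q : PowerSeries B) (i : Fin 3) :
    PowerSeries.map φ (paramArc n m a R S Q i) =
      paramArc n m a (PowerSeries.map φ R) (PowerSeries.map φ S) (PowerSeries.map φ Q) i := by
  fin_cases i <;> simp [paramArc]

theorem paramArc_equation {n m a : ℕ} (hn : a ≤ n + 1) (hm : a ≤ m + 1) (R S Q : PowerSeries B) :
    paramArc n m a R S Q 0 * paramArc n m a R S Q 1 - paramArc n m a R S Q 2 ^ (n + 1) =
      PowerSeries.X ^ (m + 1) * (R * Q) := by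
  obtain ⟨b, hb⟩ := Nat.exists_eq_add_of_le hn
  obtain ⟨c, hc⟩ := Nat.exists_eq_add_of_le hm
  simp only [paramArc, Matrix.cons_val]
  rw [show n + 1 - a = b by omega, show m + 1 - a = c by omega, hc, mul_pow, mul_pow,
    show (PowerSeries.X : PowerSeries B) ^ (n + 1) = PowerSeries.X ^ a * PowerSeries.X ^ b by
      rw [hb, pow_add], pow_add]
  ring

/-- The universal power series in the `l`-th of three families of variables. -/
noncomputable def genericSeries (l : Fin 3) : PowerSeries (MvPolynomial (Fin 3 × ℕ) ℂ) :=
  PowerSeries.mk fun j => X (l, j)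

/-- The ideal of the closure of the set of `m`-jets of the arcs `paramArc n m a R S Q`. -/
noncomputable def paramIdeal (n m a : ℕ) : Ideal (JetRing (Fin 3) m) :=
  RingHom.ker (aeval (R := ℂ)
    (jetPoint m (paramArc n m a (genericSeries 0) (genericSeries 1) (genericSeries 2))))

instance paramIdeal_isPrime (n m a : ℕ) : (paramIdeal n m a).IsPrime :=
  RingHom.ker_isPrime _

theorem aeval_jetPoint_paramArc_eq_zero [Algebra ℂ B] {n m a : ℕ} {g : JetRing (Fin 3) m}
    (hg : g ∈ paramIdeal n m a) (R S Q : PowerSeries B) :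
    aeval (jetPoint m (paramArc n m a R S Q)) g = 0 := by
  have h0 := (RingHom.mem_ker).1 hg
  have := congrArg
    (aeval (R := ℂ) fun p : Fin 3 × ℕ => PowerSeries.coeff p.2 (![R, S, Q] p.1)) h0
  rw [map_aeval_jetPoint, map_zero] at this
  simp only [map_paramArc] at this
  have hgen (l : Fin 3) : PowerSeries.map (aeval (R := ℂ) fun p : Fin 3 × ℕ =>
      PowerSeries.coeff p.2 (![R, S, Q] p.1)).toRingHom (genericSeries l) = ![R, S, Q] l := by
    ext j
    simp [genericSeries]
  rw [hgen, hgen, hgen] at this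
  exact this

theorem mem_paramIdeal_iff {n m a : ℕ} {g : JetRing (Fin 3) m} :
    g ∈ paramIdeal n m a ↔
      ∀ R S Q : PowerSeries ℂ, aeval (jetPoint m (paramArc n m a R S Q)) g = 0 := by
  refine ⟨fun hg => aeval_jetPoint_paramArc_eq_zero hg, fun h => ?_⟩
  refine (RingHom.mem_ker).2 (MvPolynomial.funext fun c => ?_)
  rw [map_zero, ← coe_aeval_eq_eval, RingHom.coe_coe, map_aeval_jetPoint]
  simp only [map_paramArc]
  exact h _ _ _

theorem paramArc_mem_jetCylinder (n m a : ℕ) (R S Q : PowerSeries ℂ) :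
    paramArc n m a R S Q ∈ jetCylinder (paramIdeal n m a) :=
  fun _ hg => aeval_jetPoint_paramArc_eq_zero hg R S Q

/-- Over a field, a solution of `x y ≡ z ^ (n + 1)` modulo `t ^ (m + 1)` for which `x` has order
exactly `a` lies in the image of the parametrization. -/
theorem eq_paramArc_of_constantCoeff_ne_zero {K : Type*} [Field K] {n m a : ℕ} (hn : a ≤ n + 1)
    (hm : a ≤ m + 1) {U W y q : PowerSeries K} (hU : PowerSeries.constantCoeff U ≠ 0)
    (h : PowerSeries.X ^ a * U * y =
      (PowerSeries.X * W) ^ (n + 1) + PowerSeries.X ^ (m + 1) * q) :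
    ![PowerSeries.X ^ a * U, y, PowerSeries.X * W] = paramArc n m a U (U⁻¹ * W) (U⁻¹ * q) := by
  have hUU := PowerSeries.mul_inv_cancel U hU
  have hU0 : U ≠ 0 := by rintro rfl; simp at hU
  have hW : U * (U⁻¹ * W) = W := by rw [← mul_assoc, hUU, one_mul]
  have hy : y = PowerSeries.X ^ (n + 1 - a) * (U ^ n * (U⁻¹ * W) ^ (n + 1)) +
      PowerSeries.X ^ (m + 1 - a) * (U⁻¹ * q) := by
    refine mul_left_cancel₀ (mul_ne_zero (pow_ne_zero a PowerSeries.X_ne_zero) hU0) ?_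
    have e := paramArc_equation hn hm U (U⁻¹ * W) (U⁻¹ * q)
    simp only [paramArc, Matrix.cons_val] at e
    rw [h, eq_add_of_sub_eq e, hW, ← mul_assoc U, hUU, one_mul, add_comm]
  simp only [paramArc, hW]
  rw [← hy]

end Parametrization

/-! ### Arcs in the parametrized components -/

section Specialization

open Polynomial

/-- A one-parameter family `(t ^ a U, t ^ b V, t W)` of arcs of contact order at least `m + 1`
over a domain `A`, with `U(0) ≠ 0`, specializes into the component parametrized by `paramArc`:
over the fraction field of `A` the family lies in the image of the parametrization. -/
theorem mem_jetCylinder_paramIdeal_of_specialization {A : Type*} [CommRing A] [IsDomain A]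
    [Algebra ℂ A] (π : A →ₐ[ℂ] ℂ) {n m a b : ℕ} (hn : a ≤ n + 1) (hm : a ≤ m + 1)
    {U V W q : A[X]} (hU : U.coeff 0 ≠ 0)
    (h : (X ^ a * U) * (X ^ b * V) = (X * W) ^ (n + 1) + X ^ (m + 1) * q) :
    (fun i => ((![X ^ a * U, X ^ b * V, X * W] i).map π.toRingHom : PowerSeries ℂ)) ∈
      jetCylinder (paramIdeal n m a) := by
  intro g hg
  let K := FractionRing A
  let j : A →ₐ[ℂ] K := IsScalarTower.toAlgHom ℂ A K
  have hj : Function.Injective j := IsFractionRing.injective A K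
  let γ : Fin 3 → PowerSeries A := fun i => (![X ^ a * U, X ^ b * V, X * W] i : A[X])
  have hK : (fun i => PowerSeries.map j.toRingHom (γ i)) =
      ![PowerSeries.X ^ a * PowerSeries.map j.toRingHom U,
        PowerSeries.map j.toRingHom ((X ^ b * V : A[X]) : PowerSeries A),
        PowerSeries.X * PowerSeries.map j.toRingHom W] := by
    funext i
    fin_cases i <;> simp [γ]
  have h1 : MvPolynomial.aeval (jetPoint m fun i => PowerSeries.map j.toRingHom (γ i)) g = 0 := by
    rw [hK, eq_paramArc_of_constantCoeff_ne_zero hn hm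
      (q := PowerSeries.map j.toRingHom (q : PowerSeries A))]
    · exact aeval_jetPoint_paramArc_eq_zero hg _ _ _
    · rw [← PowerSeries.coeff_zero_eq_constantCoeff_apply, PowerSeries.coeff_map, coeff_coe]
      exact (map_ne_zero_iff j hj).2 hU
    · have := congrArg (fun p : A[X] => PowerSeries.map j.toRingHom (p : PowerSeries A)) h
      simpa using this
  rw [← map_aeval_jetPoint] at h1
  have h2 : MvPolynomial.aeval (jetPoint m γ) g = 0 := hj (h1.trans (map_zero j).symm)
  have h3 := congrArg π h2
  rw [map_aeval_jetPoint, map_zero] at h3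
  have h4 : (fun i => PowerSeries.map π.toRingHom (γ i)) =
      fun i => ((![X ^ a * U, X ^ b * V, X * W] i).map π.toRingHom : PowerSeries ℂ) :=
    funext fun i => (polynomial_map_coe).symm
  rw [h4] at h3
  exact h3

theorem X_pow_dvd_coe_iff {k : ℕ} {p : ℂ[X]} :
    PowerSeries.X ^ k ∣ (p : PowerSeries ℂ) ↔ X ^ k ∣ p := by
  simp [PowerSeries.X_pow_dvd_iff, Polynomial.X_pow_dvd_iff]

/-- Up to order `m`, every power series is a monic polynomial of any prescribed degree `> m`. -/
theorem exists_monic_natDegree_eq_dvd_sub (φ : PowerSeries ℂ) {m d : ℕ} (hd : m < d) :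
    ∃ p : ℂ[X], p.Monic ∧ p.natDegree = d ∧
      PowerSeries.X ^ (m + 1) ∣ (p : PowerSeries ℂ) - φ := by
  have hdeg : (PowerSeries.trunc (m + 1) φ).degree < (d : WithBot ℕ) :=
    (PowerSeries.degree_trunc_lt φ (m + 1)).trans_le (by exact_mod_cast hd)
  refine ⟨X ^ d + PowerSeries.trunc (m + 1) φ, monic_X_pow_add hdeg, ?_, ?_⟩
  · exact natDegree_eq_of_degree_eq_some (by
      rw [degree_add_eq_left_of_degree_lt (by rwa [degree_X_pow]), degree_X_pow])
  · rw [coe_add, coe_pow, coe_X, add_sub_assoc]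
    exact dvd_add (pow_dvd_pow _ hd) (X_pow_dvd_trunc_sub _ _)

/-- The constant term (in `t`) of the deformation of `u v` used in `mem_jetCylinder_paramIdeal`, as a
polynomial in the parameter `s`. It is not zero: either `(w + s) ^ (n + 1)` or `s ^ (n + 2)`
contributes its leading term, and the degrees differ. -/
theorem perturbed_coeff_zero_ne_zero (n m : ℕ) (c w₀ : ℂ) :
    C c + (0 : ℂ[X]) ^ (n + 1 - min (n + 1) (m + 1)) *
        ((C w₀ + X) ^ (n + 1) - C w₀ ^ (n + 1)) +
      (0 : ℂ[X]) ^ (m + 1 - min (n + 1) (m + 1)) * X ^ (n + 2) ≠ 0 := by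
  have hmonic : ((C w₀ + X) ^ (n + 1) : ℂ[X]).Monic := by
    rw [add_comm]; exact (monic_X_add_C w₀).pow _
  have hdeg : ((C w₀ + X) ^ (n + 1) : ℂ[X]).degree = (n + 1 : ℕ) := by
    rw [add_comm, degree_pow, degree_X_add_C]; simp
  rcases lt_or_ge n m with h | h
  · rw [min_eq_left (by omega), Nat.sub_self, pow_zero, zero_pow (by omega)]
    rw [show C c + 1 * ((C w₀ + X) ^ (n + 1) - C w₀ ^ (n + 1)) + 0 * X ^ (n + 2) =
      (C w₀ + X) ^ (n + 1) + C (c - w₀ ^ (n + 1)) by simp; ring]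
    refine (hmonic.add_of_left ?_).ne_zero
    rw [hdeg]
    exact degree_C_le.trans_lt (by exact_mod_cast Nat.succ_pos n)
  · rw [min_eq_right (by omega), Nat.sub_self, pow_zero, one_mul, add_comm]
    refine (monic_X_pow_add ?_).ne_zero
    have hle : (C c + (0 : ℂ[X]) ^ (n + 1 - (m + 1)) * ((C w₀ + X) ^ (n + 1) - C w₀ ^ (n + 1))
        ).natDegree ≤ n + 1 := by
      rcases Nat.eq_zero_or_pos (n + 1 - (m + 1)) with h0 | h0
      · rw [h0]
        simp only [pow_zero, one_mul]
        compute_degree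
      · rw [zero_pow h0.ne']
        simp
    exact (degree_le_of_natDegree_le hle).trans_lt (by exact_mod_cast Nat.lt_succ_self (n + 1))

/-- The component parametrized by `paramArc n m a` contains the jets of all arcs that have contact
order at least `m + 1` with the surface and coordinates of orders at least
`(a, min (n + 1) (m + 1) - a, 1)`. The first two coordinates are `t ^ a u` and `t ^ b v` with `u`,
`v` monic polynomials without loss of generality; the third one, `t w`, is moved to `t (w + s)`,
and the factorization `u v` is deformed along with it. -/
theorem mem_jetCylinder_paramIdeal {n m a b : ℕ} (hab : a + b = min (n + 1) (m + 1))
    {γ : Fin 3 → PowerSeries ℂ} (h0 : PowerSeries.X ^ a ∣ γ 0) (h1 : PowerSeries.X ^ b ∣ γ 1)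
    (h2 : PowerSeries.X ∣ γ 2)
    (hf : PowerSeries.X ^ (m + 1) ∣ γ 0 * γ 1 - γ 2 ^ (n + 1)) :
    γ ∈ jetCylinder (paramIdeal n m a) := by
  obtain ⟨u', hu'⟩ := h0
  obtain ⟨v', hv'⟩ := h1
  obtain ⟨w', hw'⟩ := h2
  set M := min (n + 1) (m + 1) with hM
  have hMn : M ≤ n + 1 := min_le_left _ _
  have hMm : M ≤ m + 1 := min_le_right _ _
  -- `D` is the change of `u v` forced by moving `w` to `w + s` and the remainder
  -- `(x y - z ^ (n + 1)) / t ^ (m + 1)` by `s ^ (n + 2)`. It does not depend on `u` and `v`, so their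
  -- degrees can be chosen large enough for `u v + D` to be monic.
  obtain ⟨w, -, -, hw⟩ := exists_monic_natDegree_eq_dvd_sub w' (Nat.lt_succ_self m)
  let D : ℂ[X][X] := X ^ (n + 1 - M) * ((w.map C + C X) ^ (n + 1) - w.map C ^ (n + 1)) +
    X ^ (m + 1 - M) * C (X ^ (n + 2))
  obtain ⟨u, hum, hud, hu⟩ := exists_monic_natDegree_eq_dvd_sub u'
    (show m < D.natDegree + m + 1 by omega)
  obtain ⟨v, hvm, hvd, hv⟩ := exists_monic_natDegree_eq_dvd_sub v'
    (show m < D.natDegree + m + 1 by omega)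
  -- Replacing the coordinates by polynomials does not change the jet.
  let p : Fin 3 → ℂ[X] := ![X ^ a * u, X ^ b * v, X * w]
  have hp (i : Fin 3) : PowerSeries.X ^ (m + 1) ∣ (p i : PowerSeries ℂ) - γ i := by
    fin_cases i
    · simpa [p, hu', ← mul_sub] using hu.mul_left _
    · simpa [p, hv', ← mul_sub] using hv.mul_left _
    · simpa [p, hw', ← mul_sub] using hw.mul_left _
  obtain ⟨q, hq⟩ : X ^ (m + 1) ∣ p 0 * p 1 - p 2 ^ (n + 1) := by
    rw [← X_pow_dvd_coe_iff]
    have h := dvd_aeval_sub_aeval hp (singularityA n)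
    simp only [singularityA, map_sub, map_mul, map_pow, MvPolynomial.aeval_X] at h
    have := dvd_add h hf
    simpa using this
  have hq' : X ^ M * (u * v) = (X * w) ^ (n + 1) + X ^ (m + 1) * q := by
    simp only [p, Matrix.cons_val] at hq
    rw [← hab, pow_add, ← hq]
    ring
  let H : ℂ[X][X] := (u * v).map C + D
  have hdeg : D.degree < ((u * v).map (C : ℂ →+* ℂ[X])).degree := by
    refine degree_lt_degree ?_
    rw [natDegree_map_eq_of_injective C_injective, hum.natDegree_mul hvm, hud, hvd]
    omega
  have hH : H.Monic := ((hum.mul hvm).map C).add_of_left hdeg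
  have hev : (evalRingHom (0 : ℂ)).comp C = RingHom.id ℂ := RingHom.ext fun c => by simp
  have hH0 : H.map (evalRingHom 0) = u * v := by
    simp only [H, D, Polynomial.map_add, Polynomial.map_mul, Polynomial.map_pow,
      Polynomial.map_sub, Polynomial.map_map, hev, Polynomial.map_id, map_X, map_C,
      coe_evalRingHom, eval_X, eval_pow]
    simp
  obtain ⟨A, _, _, _, s, π, U, V, hs, hπ, hUV, hπU, hπV⟩ :=
    exists_factorization_deformation hum hvm hH hH0
  let ι : ℂ →+* A := algebraMap ℂ A
  have hι : (aeval (R := ℂ) s).toRingHom.comp C = ι := RingHom.ext fun c => by simp [ι]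
  have hHι : H.map (aeval (R := ℂ) s).toRingHom = (u * v).map ι +
      (X ^ (n + 1 - M) * ((w.map ι + C s) ^ (n + 1) - w.map ι ^ (n + 1)) +
        X ^ (m + 1 - M) * C (s ^ (n + 2))) := by
    simp only [H, D, Polynomial.map_add, Polynomial.map_mul, Polynomial.map_pow,
      Polynomial.map_sub, Polynomial.map_map, hι, map_X, map_C]
    simp
  have hcoeff : U.coeff 0 * V.coeff 0 = aeval s (H.coeff 0) := by
    rw [← mul_coeff_zero, hUV, coeff_map]
    rfl
  have hH00 : H.coeff 0 ≠ 0 := by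
    have hC (r : ℂ[X]) : (r.map (C : ℂ →+* ℂ[X])).eval 0 = C (r.coeff 0) := by
      rw [← coeff_zero_eq_eval_zero, coeff_map]
    rw [coeff_zero_eq_eval_zero]
    simp only [H, D, eval_add, eval_mul, eval_pow, eval_sub, eval_X, eval_C, hC]
    rw [← add_assoc]
    exact perturbed_coeff_zero_ne_zero n m ((u * v).coeff 0) (w.coeff 0)
  have hU0 : U.coeff 0 ≠ 0 := by
    intro h
    rw [h, zero_mul, eq_comm, map_eq_zero_iff _ hs] at hcoeff
    exact hH00 hcoeff
  have key := mem_jetCylinder_paramIdeal_of_specialization π (n := n) (m := m) (a := a) (b := b)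
    (by omega) (by omega) (U := U) (V := V) (W := w.map ι + C s)
    (q := q.map ι + C (s ^ (n + 2))) hU0 (by
      have e1 := congrArg (Polynomial.map ι) hq'
      simp only [Polynomial.map_mul, Polynomial.map_add, Polynomial.map_pow, map_X] at e1
      rw [Polynomial.map_mul] at hHι
      have e2 : (X : A[X]) ^ (n + 1) = X ^ M * X ^ (n + 1 - M) := by
        rw [← pow_add]; congr 1; omega
      have e3 : (X : A[X]) ^ (m + 1) = X ^ M * X ^ (m + 1 - M) := by
        rw [← pow_add]; congr 1; omega
      calc X ^ a * U * (X ^ b * V) = X ^ (a + b) * (U * V) := by ring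
        _ = _ := by
          rw [hab, hUV, hHι, mul_add, e1]
          simp only [mul_pow]
          rw [e2, e3]
          ring)
  have hpolys : (fun i => ((![X ^ a * U, X ^ b * V, X * (w.map ι + C s)] i).map π.toRingHom :
      PowerSeries ℂ)) = fun i => (p i : PowerSeries ℂ) := by
    have hπι : π.toRingHom.comp ι = RingHom.id ℂ := RingHom.ext fun c => by simp [ι]
    have hπs : π.toRingHom s = 0 := hπ
    funext i
    congr 1
    fin_cases i
    · simp [p, ← hπU]
    · simp [p, ← hπV]
    · simp only [p, Fin.reduceFinMk, Matrix.cons_val, Polynomial.map_mul, Polynomial.map_add,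
        Polynomial.map_map, hπι, Polynomial.map_id, map_X, map_C, hπs, C_0, add_zero]
  rw [hpolys, mem_jetCylinder_iff_le_ker, jetPoint_congr hp] at key
  exact key

end Specialization

/-! ### Irreducible components of the jet spaces -/

section Components

variable {n m a b ε : ℕ} {I : Ideal (MvPolynomial (Fin 3) ℂ)}

/-- The closed set `V(I)` meets the `A_n`-singularity in the points with `z = 0` if `ε = 0`, and in
the origin if `ε = 1`; expressed in terms of the arcs whose jets lie over `V(I)`. -/
def IsStandardBase (n ε : ℕ) (I : Ideal (MvPolynomial (Fin 3) ℂ)) : Prop :=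
  ∀ (m : ℕ) (γ : Fin 3 → PowerSeries ℂ),
    γ ∈ jetCylinder (jetIdealOver (singularityA n) I m) ↔
      PowerSeries.X ^ (m + 1) ∣ γ 0 * γ 1 - γ 2 ^ (n + 1) ∧
        PowerSeries.X ^ ε ∣ γ 0 ∧ PowerSeries.X ^ ε ∣ γ 1 ∧ PowerSeries.X ∣ γ 2

theorem PowerSeries.X_pow_dvd_iff_le_order {k : ℕ} {φ : PowerSeries ℂ} :
    PowerSeries.X ^ k ∣ φ ↔ (k : ℕ∞) ≤ φ.order := by
  rw [PowerSeries.order_eq_emultiplicity_X, pow_dvd_iff_le_emultiplicity]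

theorem aeval_singularityA {B : Type*} [CommRing B] [Algebra ℂ B] (γ : Fin 3 → B) :
    MvPolynomial.aeval γ (singularityA n) = γ 0 * γ 1 - γ 2 ^ (n + 1) := by
  simp [singularityA]

theorem X_pow_dvd_of_mem_jetCylinder {γ : Fin 3 → PowerSeries ℂ} {i : Fin 3} {k : ℕ}
    (hk : k ≤ m + 1) (hi : ∀ R S Q : PowerSeries ℂ, PowerSeries.X ^ k ∣ paramArc n m a R S Q i)
    (hγ : γ ∈ jetCylinder (paramIdeal n m a)) : PowerSeries.X ^ k ∣ γ i := by
  rw [PowerSeries.X_pow_dvd_iff]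
  intro j hj
  have hX : (MvPolynomial.X (i, ⟨j, by omega⟩) : JetRing (Fin 3) m) ∈ paramIdeal n m a := by
    rw [mem_paramIdeal_iff]
    intro R S Q
    rw [MvPolynomial.aeval_X]
    exact PowerSeries.X_pow_dvd_iff.1 (hi R S Q) j hj
  simpa using hγ _ hX

theorem X_pow_dvd_paramArc (hab : a + b = min (n + 1) (m + 1)) (R S Q : PowerSeries ℂ)
    (i : Fin 3) : PowerSeries.X ^ (![a, b, 1] i) ∣ paramArc n m a R S Q i := by
  fin_cases i
  · exact Dvd.intro _ rfl
  · exact dvd_add ((pow_dvd_pow _ (by simp; omega)).mul_right _)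
      ((pow_dvd_pow _ (by simp; omega)).mul_right _)
  · simp [paramArc]

theorem X_pow_dvd_of_mem_jetCylinder_paramIdeal (hab : a + b = min (n + 1) (m + 1))
    {γ : Fin 3 → PowerSeries ℂ} (hγ : γ ∈ jetCylinder (paramIdeal n m a)) (i : Fin 3) :
    PowerSeries.X ^ (![a, b, 1] i) ∣ γ i := by
  refine X_pow_dvd_of_mem_jetCylinder ?_ (fun R S Q => X_pow_dvd_paramArc hab R S Q i) hγ
  fin_cases i <;> simp <;> omega

theorem order_paramArc_one (hab : a + b = min (n + 1) (m + 1)) (i : Fin 3) :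
    (paramArc (B := ℂ) n m a 1 1 1 i).order = (![a, b, 1] i : ℕ) := by
  refine le_antisymm (PowerSeries.order_le _ ?_) ?_
  · fin_cases i
    · simp [paramArc, PowerSeries.coeff_X_pow]
    · simp only [paramArc, Fin.mk_one, Matrix.cons_val, one_pow, mul_one, map_add,
        PowerSeries.coeff_X_pow]
      have : b = n + 1 - a ∨ b = m + 1 - a := by omega
      split_ifs <;> first | omega | norm_num
    · simp [paramArc]
  · exact (PowerSeries.X_pow_dvd_iff_le_order).1 (X_pow_dvd_paramArc hab 1 1 1 i)

theorem weightVector_jetCylinder_paramIdeal (hab : a + b = min (n + 1) (m + 1)) (i : Fin 3) :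
    weightVector (jetCylinder (paramIdeal n m a)) i = (![a, b, 1] i : ℕ) := by
  refine le_antisymm ?_ ?_
  · refine (iInf₂_le _ (paramArc_mem_jetCylinder n m a 1 1 1)).trans ?_
    rw [arcOrder, MvPolynomial.aeval_X, order_paramArc_one hab]
  · refine le_iInf₂ fun γ hγ => ?_
    rw [arcOrder, MvPolynomial.aeval_X]
    exact (PowerSeries.X_pow_dvd_iff_le_order).1 (X_pow_dvd_of_mem_jetCylinder_paramIdeal hab hγ i)

theorem arcOrder_paramArc_one (hn : a ≤ n + 1) (hm : a ≤ m + 1) :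
    arcOrder (paramArc n m a 1 1 1) (singularityA n) = ((m + 1 : ℕ) : ℕ∞) := by
  rw [arcOrder, aeval_singularityA, paramArc_equation hn hm, mul_one, mul_one,
    PowerSeries.order_X_pow]

theorem IsStandardBase.jetIdealOver_le (hI : IsStandardBase n ε I) (ha : ε ≤ a) (hb : ε ≤ b)
    (hab : a + b = min (n + 1) (m + 1)) :
    jetIdealOver (singularityA n) I m ≤ paramIdeal n m a := by
  intro g hg
  rw [mem_paramIdeal_iff]
  intro R S Q
  refine mem_jetCylinder_iff.1 ((hI m _).2 ⟨?_, ?_, ?_, ?_⟩) g hg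
  · rw [paramArc_equation (by omega) (by omega)]
    exact Dvd.intro _ rfl
  · exact (pow_dvd_pow _ ha).trans (X_pow_dvd_paramArc hab R S Q 0)
  · exact (pow_dvd_pow _ hb).trans (X_pow_dvd_paramArc hab R S Q 1)
  · simpa using X_pow_dvd_paramArc hab R S Q 2

theorem PowerSeries.X_pow_dvd_mul {k : ℕ} {φ ψ : PowerSeries ℂ} {ε : ℕ} (hε : 2 * ε ≤ k)
    (hφ : PowerSeries.X ^ ε ∣ φ) (hψ : PowerSeries.X ^ ε ∣ ψ) (h : PowerSeries.X ^ k ∣ φ * ψ) :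
    ∃ a b, a + b = k ∧ ε ≤ a ∧ ε ≤ b ∧ PowerSeries.X ^ a ∣ φ ∧ PowerSeries.X ^ b ∣ ψ := by
  by_cases hφk : PowerSeries.X ^ (k - ε) ∣ φ
  · exact ⟨k - ε, ε, by omega, by omega, le_rfl, hφk, hψ⟩
  rw [PowerSeries.X_pow_dvd_iff_le_order] at hφ hφk
  rw [not_le] at hφk
  obtain ⟨a, ha⟩ := ENat.ne_top_iff_exists.1 hφk.ne_top
  rw [← ha] at hφ hφk
  norm_cast at hφ hφk
  refine ⟨a, k - a, by omega, hφ, by omega, ?_, ?_⟩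
  · rw [PowerSeries.X_pow_dvd_iff_le_order, ← ha]
  · rw [PowerSeries.X_pow_dvd_iff_le_order, PowerSeries.order_mul, ← ha] at h
    rw [PowerSeries.X_pow_dvd_iff_le_order]
    cases hψo : ψ.order with
    | top => exact le_top
    | coe c => rw [hψo] at h; norm_cast at h ⊢; omega

theorem IsStandardBase.exists_mem_jetCylinder (hI : IsStandardBase n ε I)
    (hε : 2 * ε ≤ min (n + 1) (m + 1)) {γ : Fin 3 → PowerSeries ℂ}
    (hγ : γ ∈ jetCylinder (jetIdealOver (singularityA n) I m)) :
    ∃ a b, a + b = min (n + 1) (m + 1) ∧ ε ≤ a ∧ ε ≤ b ∧ γ ∈ jetCylinder (paramIdeal n m a) := by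
  obtain ⟨hf, h0, h1, h2⟩ := (hI m γ).1 hγ
  have h : PowerSeries.X ^ min (n + 1) (m + 1) ∣ γ 0 * γ 1 := by
    have := dvd_add ((pow_dvd_pow _ (min_le_right (n + 1) (m + 1))).trans hf)
      ((pow_dvd_pow _ (min_le_left (n + 1) (m + 1))).trans (pow_dvd_pow_of_dvd h2 (n + 1)))
    simpa using this
  obtain ⟨a, b, hab, ha, hb, hγ0, hγ1⟩ := PowerSeries.X_pow_dvd_mul hε h0 h1 h
  exact ⟨a, b, hab, ha, hb, mem_jetCylinder_paramIdeal hab hγ0 hγ1 h2 hf⟩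

theorem exists_jetPoint_eq {ι : Type*} {m : ℕ} (x : ι × Fin (m + 1) → ℂ) :
    ∃ γ : ι → PowerSeries ℂ, jetPoint m γ = x := by
  refine ⟨fun i => PowerSeries.mk fun j => if h : j < m + 1 then x (i, ⟨j, h⟩) else 0, ?_⟩
  funext p
  have hp : (p.2 : ℕ) < m + 1 := p.2.2
  rw [jetPoint, PowerSeries.coeff_mk, dif_pos hp]

/-- If the zero locus of `J` is covered by those of finitely many ideals `Q k`, then every prime
ideal above `J` lies above one of them. -/
theorem exists_le_of_jetCylinder_cover {ι κ : Type*} [Finite ι] {m : ℕ}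
    {J P : Ideal (JetRing ι m)} {Q : κ → Ideal (JetRing ι m)} (s : Finset κ)
    (hcov : ∀ γ ∈ jetCylinder J, ∃ k ∈ s, γ ∈ jetCylinder (Q k)) (hP : P.IsPrime) (hJ : J ≤ P) :
    ∃ k ∈ s, Q k ≤ P := by
  rw [← hP.prod_le]
  refine le_trans ?_ ((Ideal.IsPrime.radical_le_iff hP).2 hJ)
  rw [← MvPolynomial.vanishingIdeal_zeroLocus_eq_radical (K := ℂ)]
  intro g hg x hx
  obtain ⟨γ, rfl⟩ := exists_jetPoint_eq x
  obtain ⟨k, hk, hγ⟩ := hcov γ hx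
  exact hγ g (Ideal.prod_le_inf.trans (Finset.inf_le hk) hg)

theorem eq_of_jetCylinder_paramIdeal_subset {a' b' : ℕ} (hab : a + b = min (n + 1) (m + 1))
    (hab' : a' + b' = min (n + 1) (m + 1))
    (h : jetCylinder (paramIdeal n m a') ⊆ jetCylinder (paramIdeal n m a)) : a = a' := by
  have key (i : Fin 3) : ![a, b, 1] i ≤ ![a', b', 1] i := by
    have := (PowerSeries.X_pow_dvd_iff_le_order).1 <| X_pow_dvd_of_mem_jetCylinder_paramIdeal hab
      (h (paramArc_mem_jetCylinder n m a' 1 1 1)) i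
    rw [order_paramArc_one hab'] at this
    exact_mod_cast this
  have h0 := key 0
  have h1 := key 1
  simp at h0 h1
  omega

/-- The irreducible components of the `m`-jets over a standard base are the parametrized sets with
generic orders `(a, b, 1)`, where `a + b = min (n + 1) (m + 1)` and `ε ≤ a, b`. -/
theorem IsStandardBase.minimalPrimes_eq (hI : IsStandardBase n ε I)
    (hε : 2 * ε ≤ min (n + 1) (m + 1)) :
    (jetIdealOver (singularityA n) I m).minimalPrimes =
      {P | ∃ a b, a + b = min (n + 1) (m + 1) ∧ ε ≤ a ∧ ε ≤ b ∧ P = paramIdeal n m a} := by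
  have hmin (P : Ideal (JetRing (Fin 3) m)) (hP : P.IsPrime)
      (hJ : jetIdealOver (singularityA n) I m ≤ P) :
      ∃ a b, a + b = min (n + 1) (m + 1) ∧ ε ≤ a ∧ ε ≤ b ∧ paramIdeal n m a ≤ P := by
    obtain ⟨k, hk, hkP⟩ := exists_le_of_jetCylinder_cover (Q := paramIdeal n m)
      ((Finset.range (min (n + 1) (m + 1) + 1)).filter
        fun a => ε ≤ a ∧ ε ≤ min (n + 1) (m + 1) - a)
      (fun γ hγ => by
        obtain ⟨a, b, hab, ha, hb, h⟩ := hI.exists_mem_jetCylinder hε hγ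
        exact ⟨a, Finset.mem_filter.2 ⟨Finset.mem_range.2 (by omega), ha, by omega⟩, h⟩) hP hJ
    rw [Finset.mem_filter, Finset.mem_range] at hk
    exact ⟨k, min (n + 1) (m + 1) - k, by omega, hk.2.1, hk.2.2, hkP⟩
  ext P
  constructor
  · rintro ⟨⟨hP, hJ⟩, hPmin⟩
    obtain ⟨a, b, hab, ha, hb, haP⟩ := hmin P hP hJ
    exact ⟨a, b, hab, ha, hb,
      le_antisymm (hPmin ⟨inferInstance, hI.jetIdealOver_le ha hb hab⟩ haP) haP⟩
  · rintro ⟨a, b, hab, ha, hb, rfl⟩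
    refine ⟨⟨inferInstance, hI.jetIdealOver_le ha hb hab⟩, fun P ⟨hP, hJ⟩ hPa => ?_⟩
    obtain ⟨a', b', hab', -, -, haP⟩ := hmin P hP hJ
    obtain rfl := eq_of_jetCylinder_paramIdeal_subset hab' hab (jetCylinder_anti (haP.trans hPa))
    exact haP

theorem IsStandardBase.isContactCylinder_iff (hI : IsStandardBase n ε I)
    (hε : 2 * ε ≤ min (n + 1) (m + 1)) {S : Set (Fin 3 → PowerSeries ℂ)} :
    IsContactCylinder (singularityA n) I m S ↔
      ∃ a b, a + b = min (n + 1) (m + 1) ∧ ε ≤ a ∧ ε ≤ b ∧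
        S = jetCylinder (paramIdeal n m a) := by
  rw [IsContactCylinder, jetComponentCylinders, hI.minimalPrimes_eq hε]
  constructor
  · rintro ⟨⟨P, ⟨a, b, hab, ha, hb, rfl⟩, rfl⟩, -⟩
    exact ⟨a, b, hab, ha, hb, rfl⟩
  · rintro ⟨a, b, hab, ha, hb, rfl⟩
    exact ⟨⟨_, ⟨a, b, hab, ha, hb, rfl⟩, rfl⟩, _, paramArc_mem_jetCylinder n m a 1 1 1,
      arcOrder_paramArc_one (by omega) (by omega)⟩

/-- Over the singular point the `0`-jets violate the contact condition, because the equation has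
multiplicity two there. -/
theorem IsStandardBase.not_isContactCylinder_zero (hI : IsStandardBase n ε I) (hε : 1 ≤ ε)
    (hn : 1 ≤ n) {S : Set (Fin 3 → PowerSeries ℂ)} :
    ¬ IsContactCylinder (singularityA n) I 0 S := by
  rintro ⟨⟨P, hP, rfl⟩, γ, hγ, hord⟩
  obtain ⟨-, h0, h1, h2⟩ := (hI 0 γ).1 (jetCylinder_anti hP.1.2 hγ)
  have h : PowerSeries.X ^ 2 ∣ γ 0 * γ 1 - γ 2 ^ (n + 1) := by
    refine dvd_sub ?_ ((pow_dvd_pow_of_dvd h2 2).trans (pow_dvd_pow _ (by omega)))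
    rw [pow_two]
    exact mul_dvd_mul ((dvd_pow_self _ (by omega)).trans h0) ((dvd_pow_self _ (by omega)).trans h1)
  rw [arcOrder, aeval_singularityA] at hord
  rw [PowerSeries.X_pow_dvd_iff_le_order, hord] at h
  norm_cast at h

/-- The `(m + 1)`-jets of the parametrized arcs with index `a` are truncated to `m`-jets of such arcs
with the same index. For `m ≥ n` the two components also have the same generic orders. -/
theorem jetCylinder_paramIdeal_succ_subset (ha : a ≤ m + 1) :
    jetCylinder (paramIdeal n (m + 1) a) ⊆ jetCylinder (paramIdeal n m a) := by
  intro γ hγ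
  rw [mem_jetCylinder_iff] at hγ ⊢
  intro g hg
  let r : Fin 3 × Fin (m + 1) → Fin 3 × Fin (m + 1 + 1) := fun p => (p.1, p.2.castSucc)
  have hr (δ : Fin 3 → PowerSeries ℂ) : MvPolynomial.aeval (jetPoint (m + 1) δ)
      (MvPolynomial.rename r g) = MvPolynomial.aeval (jetPoint m δ) g := by
    rw [MvPolynomial.aeval_rename]
    rfl
  rw [← hr]
  refine hγ _ (mem_paramIdeal_iff.2 fun R S Q => ?_)
  have hQ : paramArc n (m + 1) a R S Q = paramArc n m a R S (PowerSeries.X * Q) := by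
    simp only [paramArc]
    rw [show m + 1 + 1 - a = m + 1 - a + 1 by omega, pow_succ PowerSeries.X (m + 1 - a),
      mul_assoc _ PowerSeries.X Q]
  rw [hr, hQ]
  exact aeval_jetPoint_paramArc_eq_zero hg _ _ _

end Components

/-! ### Valuations of the components -/

section Valuations

open MvPolynomial

theorem aeval_eq_sum {ι B : Type*} [Fintype ι] [CommRing B] [Algebra ℂ B] (γ : ι → B)
    (h : MvPolynomial ι ℂ) :
    aeval γ h = ∑ α ∈ h.support, algebraMap ℂ B (h.coeff α) * ∏ i, γ i ^ α i := by
  rw [aeval_def, eval₂_eq']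

/-- The arcs whose coordinates vanish to orders at least `v` define the monomial valuation with
weights `v`: along the arcs `c i * t ^ v i`, the coefficient of `t ^ d` in `h` is the value at `c`
of the part of `h` of weight `d`. -/
theorem cylinderValuation_eq_monomialValuation {ι : Type*} [Fintype ι] (v : ι → ℕ) :
    cylinderValuation {γ : ι → PowerSeries ℂ | ∀ i, PowerSeries.X ^ v i ∣ γ i} =
      monomialValuation fun i => (v i : ℤ) := by
  classical
  funext h
  simp only [cylinderValuation, monomialValuation, Int.toNat_natCast]
  refine le_antisymm (le_iInf₂ fun α hα => ?_) (le_iInf₂ fun γ hγ => ?_)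
  · let d := ∑ i, v i * α i
    let p : MvPolynomial ι ℂ :=
      ∑ β ∈ h.support with ∑ i, v i * β i = d, monomial β (h.coeff β)
    have hp : p ≠ 0 := by
      intro h0
      have := congrArg (MvPolynomial.coeff α) h0
      simp only [p, coeff_sum, coeff_monomial, coeff_zero] at this
      have hmem : α ∈ h.support.filter fun β => ∑ i, v i * β i = d :=
        Finset.mem_filter.2 ⟨hα, rfl⟩
      rw [Finset.sum_ite_eq', if_pos hmem] at this
      exact mem_support_iff.1 hα this
    obtain ⟨c, hc⟩ : ∃ c, eval c p ≠ 0 := by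
      by_contra! hall
      exact hp (MvPolynomial.funext fun c => by rw [hall, map_zero])
    refine (iInf₂_le (fun i => PowerSeries.C (c i) * PowerSeries.X ^ v i)
      fun i => Dvd.intro_left _ rfl).trans (PowerSeries.order_le d ?_)
    convert hc using 1
    rw [aeval_eq_sum, map_sum, map_sum, Finset.sum_filter]
    refine Finset.sum_congr rfl fun β _ => ?_
    have hprod : ∏ i, (PowerSeries.C (c i) * PowerSeries.X ^ v i) ^ β i =
        PowerSeries.C (∏ i, c i ^ β i) * PowerSeries.X ^ ∑ i, v i * β i := by
      simp only [mul_pow, Finset.prod_mul_distrib, ← pow_mul, Finset.prod_pow_eq_pow_sum,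
        map_prod, map_pow]
    rw [hprod, PowerSeries.algebraMap_apply, Algebra.algebraMap_self, RingHom.id_apply,
      PowerSeries.coeff_C_mul, PowerSeries.coeff_C_mul, PowerSeries.coeff_X_pow, eval_monomial,
      Finsupp.prod_fintype _ _ fun i => pow_zero _]
    simp only [eq_comm (a := d), mul_ite, mul_one, mul_zero]
  · refine PowerSeries.le_order _ _ fun d hd => ?_
    rw [aeval_eq_sum, map_sum]
    refine Finset.sum_eq_zero fun α hα => ?_
    have hdvd : PowerSeries.X ^ ∑ i, v i * α i ∣ ∏ i, γ i ^ α i := by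
      rw [← Finset.prod_pow_eq_pow_sum]
      refine Finset.prod_dvd_prod_of_dvd _ _ fun i _ => ?_
      rw [pow_mul]
      exact pow_dvd_pow_of_dvd (hγ i) _
    refine PowerSeries.X_pow_dvd_iff.1 (hdvd.mul_left _) d ?_
    exact_mod_cast hd.trans_le (iInf₂_le α hα)

variable {n m a b ε : ℕ} {I : Ideal (MvPolynomial (Fin 3) ℂ)}

theorem jetCylinder_paramIdeal_eq (hm : m ≤ n) (hab : a + b = m + 1) :
    jetCylinder (paramIdeal n m a) =
      {γ : Fin 3 → PowerSeries ℂ | ∀ i, PowerSeries.X ^ (![a, b, 1] i) ∣ γ i} := by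
  have hab' : a + b = min (n + 1) (m + 1) := by omega
  refine Set.Subset.antisymm
    (fun γ hγ => X_pow_dvd_of_mem_jetCylinder_paramIdeal hab' hγ) fun γ hγ => ?_
  have h0 : PowerSeries.X ^ a ∣ γ 0 := hγ 0
  have h1 : PowerSeries.X ^ b ∣ γ 1 := hγ 1
  have h2 : PowerSeries.X ∣ γ 2 := by simpa using hγ 2
  refine mem_jetCylinder_paramIdeal hab' h0 h1 h2 (dvd_sub ?_ ?_)
  · rw [← hab, pow_add]
    exact mul_dvd_mul h0 h1
  · exact (pow_dvd_pow _ (by omega)).trans (pow_dvd_pow_of_dvd h2 (n + 1))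

theorem cylinderValuation_jetCylinder_paramIdeal (hm : m ≤ n) (hab : a + b = m + 1) :
    cylinderValuation (jetCylinder (paramIdeal n m a)) =
      monomialValuation ![(a : ℤ), (b : ℤ), 1] := by
  rw [jetCylinder_paramIdeal_eq hm hab, cylinderValuation_eq_monomialValuation]
  congr 1
  funext i
  fin_cases i <;> rfl

/-- The components of the `m`-jets are essential for `m ≤ n`, where their generic orders add up to
`m + 2`, and never for `m > n`, where the generic orders repeat those of the `(m - 1)`-jets. -/
theorem IsStandardBase.embeddedValuations_eq (hI : IsStandardBase n ε I)
    (hε : ε = 0 ∨ ε = 1 ∧ 1 ≤ n) :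
    embeddedValuations (singularityA n) I =
      {ν | ∃ a b : ℕ, ε ≤ a ∧ ε ≤ b ∧ 1 ≤ a + b ∧ a + b ≤ n + 1 ∧
        ν = monomialValuation ![(a : ℤ), (b : ℤ), 1]} := by
  have hlow {k : ℕ} {T : Set (Fin 3 → PowerSeries ℂ)}
      (hT : IsContactCylinder (singularityA n) I k T) : 2 * ε ≤ min (n + 1) (k + 1) := by
    by_contra hlt
    obtain rfl : k = 0 := by omega
    exact hI.not_isContactCylinder_zero (by omega) (by omega) hT
  ext ν
  constructor
  · rintro ⟨m, S, ⟨hS, hess⟩, rfl⟩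
    obtain ⟨a, b, hab, ha, hb, rfl⟩ := (hI.isContactCylinder_iff (hlow hS)).1 hS
    rcases le_or_gt m n with hm | hm
    · exact ⟨a, b, ha, hb, by omega, by omega,
        cylinderValuation_jetCylinder_paramIdeal hm (by omega)⟩
    · obtain ⟨k, rfl⟩ := Nat.exists_eq_add_of_le' (Nat.one_le_of_lt hm)
      have habk : a + b = min (n + 1) (k + 1) := by omega
      refine absurd ?_ (hess k (jetCylinder (paramIdeal n k a)) rfl
        ((hI.isContactCylinder_iff (by omega)).2 ⟨a, b, habk, ha, hb, rfl⟩)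
        (jetCylinder_paramIdeal_succ_subset (by omega)))
      funext i
      rw [weightVector_jetCylinder_paramIdeal hab, weightVector_jetCylinder_paramIdeal habk]
  · rintro ⟨a, b, ha, hb, h1, hn, rfl⟩
    obtain ⟨m, hm⟩ := Nat.exists_eq_add_of_le' h1
    have hab : a + b = min (n + 1) (m + 1) := by omega
    refine ⟨m, jetCylinder (paramIdeal n m a), ⟨(hI.isContactCylinder_iff (by omega)).2
      ⟨a, b, hab, ha, hb, rfl⟩, ?_⟩,
      (cylinderValuation_jetCylinder_paramIdeal (by omega) hm).symm⟩
    rintro k T rfl hT - hw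
    obtain ⟨a', b', hab', -, -, rfl⟩ := (hI.isContactCylinder_iff (hlow hT)).1 hT
    have key (i : Fin 3) : ![a, b, 1] i = ![a', b', 1] i := by
      have := congrFun hw i
      rw [weightVector_jetCylinder_paramIdeal hab, weightVector_jetCylinder_paramIdeal hab'] at this
      exact_mod_cast this
    have e0 : a = a' := key 0
    have e1 : b = b' := key 1
    omega

end Valuations

/-! ### The two base loci -/

section Bases

open MvPolynomial

theorem isStandardBase_coordHyperplanes (n : ℕ) :
    IsStandardBase n 0 (coordHyperplanesIdeal (Fin 3)) := by
  intro m γ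
  rw [mem_jetCylinder_jetIdealOver, aeval_singularityA, coordHyperplanesIdeal,
    Ideal.span_singleton_le_iff_mem, RingHom.mem_ker]
  simp only [Fin.prod_univ_three, map_mul, aeval_X, pow_zero, isUnit_one, IsUnit.dvd, true_and]
  refine and_congr_right fun hf => ?_
  have h0 : PowerSeries.constantCoeff (γ 0) * PowerSeries.constantCoeff (γ 1) =
      PowerSeries.constantCoeff (γ 2) ^ (n + 1) := by
    have := PowerSeries.X_pow_dvd_iff.1 hf 0 (Nat.succ_pos m)
    simpa [sub_eq_zero] using this
  rw [h0, PowerSeries.X_dvd_iff, ← pow_succ, pow_eq_zero_iff (by omega)]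

theorem aeval_pderiv_singularityA (n : ℕ) (c : Fin 3 → ℂ) (i : Fin 3) :
    aeval c (pderiv i (singularityA n)) = ![c 1, c 0, -((n + 1) * c 2 ^ n)] i := by
  fin_cases i <;> simp [singularityA, pderiv_X]

theorem singularIdeal_le_ker_iff {n : ℕ} {c : Fin 3 → ℂ} :
    singularIdeal (singularityA n) ≤ RingHom.ker (aeval (R := ℂ) c) ↔
      c 0 * c 1 - c 2 ^ (n + 1) = 0 ∧ c 1 = 0 ∧ c 0 = 0 ∧ c 2 ^ n = 0 := by
  rw [singularIdeal, Ideal.span_le, Set.insert_subset_iff, Set.range_subset_iff]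
  simp only [SetLike.mem_coe, RingHom.mem_ker, aeval_singularityA, aeval_pderiv_singularityA,
    Fin.forall_fin_succ]
  have : (n + 1 : ℂ) ≠ 0 := Nat.cast_add_one_ne_zero n
  simp [this]

theorem isStandardBase_singularIdeal {n : ℕ} (hn : 1 ≤ n) :
    IsStandardBase n 1 (singularIdeal (singularityA n)) := by
  intro m γ
  rw [mem_jetCylinder_jetIdealOver, aeval_singularityA, singularIdeal_le_ker_iff]
  simp only [pow_one, PowerSeries.X_dvd_iff, pow_eq_zero_iff (Nat.one_le_iff_ne_zero.1 hn)]
  refine and_congr_right fun _ =>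
    ⟨fun h => ⟨h.2.2.1, h.2.1, h.2.2.2⟩, fun h => ⟨?_, h.2.1, h.1, h.2.2⟩⟩
  rw [h.1, h.2.2]
  simp

theorem embeddedValuations_singularIdeal_zero :
    embeddedValuations (singularityA 0) (singularIdeal (singularityA 0)) = ∅ := by
  refine Set.eq_empty_of_forall_notMem ?_
  rintro _ ⟨m, _, ⟨⟨⟨P, hP, rfl⟩, γ, hγ, -⟩, -⟩, -⟩
  have h := (mem_jetCylinder_jetIdealOver.1 (jetCylinder_anti hP.1.2 hγ)).2
  simp [singularIdeal_le_ker_iff] at h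

end Bases

/-! ### The Gröbner fan of the `A_n`-singularity -/

section Fan

open MvPolynomial

theorem singularityA_eq (n : ℕ) : singularityA n =
    monomial (Finsupp.single 0 1 + Finsupp.single 1 1) 1 -
      monomial (Finsupp.single 2 (n + 1)) 1 := by
  rw [singularityA, X_pow_eq_monomial, X, X, monomial_mul, one_mul]

theorem support_singularityA (n : ℕ) : (singularityA n).support =
    {Finsupp.single 0 1 + Finsupp.single 1 1, Finsupp.single 2 (n + 1)} := by
  classical
  have hne : (Finsupp.single 0 1 + Finsupp.single 1 1 : Fin 3 →₀ ℕ) ≠ Finsupp.single 2 (n + 1) := by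
    intro h
    simpa using DFunLike.congr_fun h 0
  ext α
  rw [mem_support_iff, singularityA_eq, coeff_sub, coeff_monomial, coeff_monomial,
    Finset.mem_insert, Finset.mem_singleton]
  split_ifs with h1 h2 h2
  · exact absurd (h1.trans h2.symm) hne
  · simp [h1]
  · simp [h2]
  · exact iff_of_false (by simp) (by rintro (h | h); exacts [h1 h.symm, h2 h.symm])

theorem mem_support_initialForm {v : Fin 3 → ℝ} {f : MvPolynomial (Fin 3) ℂ} {α : Fin 3 →₀ ℕ} :
    α ∈ (initialForm v f).support ↔
      α ∈ f.support ∧ ∀ β ∈ f.support, expWeight v α ≤ expWeight v β := by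
  classical
  rw [initialForm, mem_support_iff, coeff_sum]
  simp only [coeff_monomial]
  rw [Finset.sum_ite_eq']
  simp only [Finset.mem_filter]
  split_ifs with h
  · exact iff_of_true (mem_support_iff.1 h.1) h
  · exact iff_of_false (by simp) h

theorem initialForm_eq_iff {v w : Fin 3 → ℝ} {f : MvPolynomial (Fin 3) ℂ} :
    initialForm w f = initialForm v f ↔ ∀ α ∈ f.support,
      (∀ β ∈ f.support, expWeight w α ≤ expWeight w β) ↔
        ∀ β ∈ f.support, expWeight v α ≤ expWeight v β := by
  classical
  refine ⟨fun h α hα => ?_, fun h => ?_⟩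
  · have := congrArg (fun g => α ∈ g.support) h
    simpa only [mem_support_initialForm, hα, true_and, eq_iff_iff] using this
  · rw [initialForm, initialForm]
    congr 1
    exact Finset.filter_congr h

/-- The initial form of `x y - z ^ (n + 1)` is determined by the comparison of the weights of its
two terms. -/
theorem initialForm_singularityA_eq_iff {n : ℕ} {v w : Fin 3 → ℝ} :
    initialForm w (singularityA n) = initialForm v (singularityA n) ↔
      (w 0 + w 1 ≤ (n + 1) * w 2 ↔ v 0 + v 1 ≤ (n + 1) * v 2) ∧
        ((n + 1) * w 2 ≤ w 0 + w 1 ↔ (n + 1) * v 2 ≤ v 0 + v 1) := by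
  rw [initialForm_eq_iff, support_singularityA]
  simp only [Finset.mem_insert, Finset.mem_singleton, forall_eq_or_imp, forall_eq, le_refl,
    true_and, and_true]
  have e1 (u : Fin 3 → ℝ) : expWeight u (Finsupp.single 0 1 + Finsupp.single 1 1) = u 0 + u 1 := by
    simp [expWeight, Fin.sum_univ_three]
  have e2 (u : Fin 3 → ℝ) : expWeight u (Finsupp.single 2 (n + 1)) = (n + 1) * u 2 := by
    simp [expWeight, Fin.sum_univ_three, mul_comm]
  simp only [e1, e2]

/-- The Gröbner cone on which `z ^ (n + 1)` is the initial form. -/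
def powerCone (n : ℕ) : Set (Fin 3 → ℝ) := {w | 0 ≤ w ∧ (n + 1) * w 2 ≤ w 0 + w 1}

/-- The Gröbner cone on which `x y` is the initial form. -/
def productCone (n : ℕ) : Set (Fin 3 → ℝ) := {w | 0 ≤ w ∧ w 0 + w 1 ≤ (n + 1) * w 2}

theorem isClosed_powerCone (n : ℕ) : IsClosed (powerCone n) :=
  isClosed_Ici.inter (isClosed_le (f := fun w : Fin 3 → ℝ => (n + 1) * w 2)
    (g := fun w => w 0 + w 1) (by fun_prop) (by fun_prop))

theorem isClosed_productCone (n : ℕ) : IsClosed (productCone n) :=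
  isClosed_Ici.inter (isClosed_le (f := fun w : Fin 3 → ℝ => w 0 + w 1)
    (g := fun w => (n + 1) * w 2) (by fun_prop) (by fun_prop))

theorem mem_closure_of_forall_add_smul_mem {s : Set (Fin 3 → ℝ)} {x d : Fin 3 → ℝ}
    (h : ∀ r : ℝ, 0 < r → x + r • d ∈ s) : x ∈ closure s := by
  have ht : Filter.Tendsto (fun r : ℝ => x + r • d) (nhdsWithin 0 (Set.Ioi 0)) (nhds x) := by
    have hc : Continuous fun r : ℝ => x + r • d := by fun_prop
    simpa using (hc.tendsto 0).mono_left nhdsWithin_le_nhds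
  exact mem_closure_of_tendsto ht (Filter.eventually_of_mem self_mem_nhdsWithin fun r hr => h r hr)

theorem groebnerCone_of_lt {n : ℕ} {v : Fin 3 → ℝ} (h : (n + 1) * v 2 < v 0 + v 1) :
    groebnerCone (singularityA n) v = powerCone n := by
  refine Set.Subset.antisymm (closure_minimal ?_ (isClosed_powerCone n)) fun x hx => ?_
  · rintro w ⟨hw, he⟩
    exact ⟨hw, (initialForm_singularityA_eq_iff.1 he).2.2 h.le⟩
  · refine mem_closure_of_forall_add_smul_mem (d := ![1, 0, 0]) fun r hr => ⟨fun i => ?_, ?_⟩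
    · have := hx.1 i
      fin_cases i <;> simp at this ⊢ <;> linarith
    · have := hx.2
      rw [initialForm_singularityA_eq_iff]
      simp
      constructor
      · constructor <;> intro <;> linarith
      · constructor <;> intro <;> linarith

theorem groebnerCone_of_gt {n : ℕ} {v : Fin 3 → ℝ} (h : v 0 + v 1 < (n + 1) * v 2) :
    groebnerCone (singularityA n) v = productCone n := by
  refine Set.Subset.antisymm (closure_minimal ?_ (isClosed_productCone n)) fun x hx => ?_
  · rintro w ⟨hw, he⟩
    exact ⟨hw, (initialForm_singularityA_eq_iff.1 he).1.2 h.le⟩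
  · refine mem_closure_of_forall_add_smul_mem (d := ![0, 0, 1]) fun r hr => ⟨fun i => ?_, ?_⟩
    · have := hx.1 i
      fin_cases i <;> simp at this ⊢ <;> linarith
    · have := hx.2
      have hr' : 0 < (n + 1) * r := by positivity
      rw [initialForm_singularityA_eq_iff]
      simp
      constructor
      · constructor <;> intro <;> linarith
      · constructor <;> intro <;> linarith

theorem span_groebnerCone_ne_top {n : ℕ} {v : Fin 3 → ℝ} (h : v 0 + v 1 = (n + 1) * v 2) :
    Submodule.span ℝ (groebnerCone (singularityA n) v) ≠ ⊤ := by
  let e (i : Fin 3) : (Fin 3 → ℝ) →ₗ[ℝ] ℝ := LinearMap.proj i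
  let φ := e 0 + e 1 - (n + 1 : ℝ) • e 2
  have hle : Submodule.span ℝ (groebnerCone (singularityA n) v) ≤ LinearMap.ker φ := by
    refine Submodule.span_le.2 (closure_minimal ?_ (LinearMap.ker φ).closed_of_finiteDimensional)
    rintro w ⟨-, he⟩
    rw [initialForm_singularityA_eq_iff] at he
    have h1 := he.1.2 h.le
    have h2 := he.2.2 h.ge
    simp [φ, e]
    linarith
  intro htop
  rw [htop] at hle
  have := hle (Submodule.mem_top (x := ![1, 0, 0]))
  simp [φ, e] at this

theorem span_eq_top_of_mem {s : Set (Fin 3 → ℝ)} {u v w : Fin 3 → ℝ} (hu : u ∈ s) (hv : v ∈ s)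
    (hw : w ∈ s) (h : ∀ i : Fin 3, Pi.single i (1 : ℝ) ∈ Submodule.span ℝ {u, v, w}) :
    Submodule.span ℝ s = ⊤ := by
  have h1 : Submodule.span ℝ {u, v, w} ≤ Submodule.span ℝ s :=
    Submodule.span_mono (by rintro _ (rfl | rfl | rfl) <;> assumption)
  rw [eq_top_iff, ← (Pi.basisFun ℝ (Fin 3)).span_eq, Submodule.span_le]
  rintro _ ⟨i, rfl⟩
  rw [Pi.basisFun_apply]
  exact h1 (h i)

theorem maximalGroebnerCones_singularityA (n : ℕ) :
    maximalGroebnerCones (singularityA n) = {powerCone n, productCone n} := by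
  have hn : (0 : ℝ) < n + 1 := by positivity
  ext C
  constructor
  · rintro ⟨v, -, rfl, htop⟩
    rcases lt_trichotomy ((n + 1) * v 2) (v 0 + v 1) with h | h | h
    · exact Or.inl (groebnerCone_of_lt h)
    · exact absurd htop (span_groebnerCone_ne_top h.symm)
    · exact Or.inr (groebnerCone_of_gt h)
  · rintro (rfl | rfl)
    · refine ⟨![1, 0, 0], by intro i; fin_cases i <;> simp, (groebnerCone_of_lt (by simp)).symm, ?_⟩
      refine span_eq_top_of_mem (u := ![1, 0, 0]) (v := ![0, 1, 0]) (w := ![n + 1, 0, 1])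
        ⟨by intro i; fin_cases i <;> simp, by simp⟩ ⟨by intro i; fin_cases i <;> simp, by simp⟩
        ⟨by intro i; fin_cases i <;> simp; positivity, by simp⟩ fun i => ?_
      simp only [Submodule.mem_span_insert, Submodule.mem_span_singleton]
      fin_cases i
      · exact ⟨1, 0, ⟨0, 0, ⟨0, by simp⟩, by simp⟩, by ext j; fin_cases j <;> simp⟩
      · exact ⟨0, _, ⟨1, 0, ⟨0, by simp⟩, rfl⟩, by ext j; fin_cases j <;> simp⟩
      · exact ⟨-(n + 1), _, ⟨0, _, ⟨1, rfl⟩, rfl⟩, by ext j; fin_cases j <;> simp⟩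
    · refine ⟨![0, 0, 1], by intro i; fin_cases i <;> simp,
        (groebnerCone_of_gt (by simpa using hn)).symm, ?_⟩
      refine span_eq_top_of_mem (u := ![1, 0, 1]) (v := ![0, 1, 1]) (w := ![0, 0, 1])
        ⟨by intro i; fin_cases i <;> simp, by simp⟩ ⟨by intro i; fin_cases i <;> simp, by simp⟩
        ⟨by intro i; fin_cases i <;> simp, by simpa using hn.le⟩ fun i => ?_
      simp only [Submodule.mem_span_insert, Submodule.mem_span_singleton]
      fin_cases i
      · exact ⟨1, _, ⟨0, _, ⟨-1, rfl⟩, rfl⟩, by ext j; fin_cases j <;> simp⟩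
      · exact ⟨0, _, ⟨1, _, ⟨-1, rfl⟩, rfl⟩, by ext j; fin_cases j <;> simp⟩
      · exact ⟨0, _, ⟨0, _, ⟨1, rfl⟩, rfl⟩, by ext j; fin_cases j <;> simp⟩

/-! ### Profiles of the two maximal cones -/

/-- A summand in the cone `C` of a vector on an extremal ray of `C` lies on that ray. -/
theorem exists_eq_smul_of_mem_extremalVectors {C : Set (Fin 3 → ℝ)}
    (hC : ∀ x ∈ C, (2 : ℝ) • x ∈ C) {v : Fin 3 → ℤ} (hv : v ∈ extremalVectors C)
    {x y : Fin 3 → ℝ} (hx : x ∈ C) (hy : y ∈ C) (h : (fun i => (v i : ℝ)) = x + y) :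
    ∃ c : ℝ, ∀ i, x i = c * v i := by
  obtain ⟨r, -, hr⟩ := hv.2.left_mem_of_mem_openSegment (hC x hx) (hC y hy)
    (z := fun i => (v i : ℝ)) ⟨1, zero_le_one, (one_smul ℝ _).symm⟩
    ⟨1 / 2, 1 / 2, by norm_num, by norm_num, by norm_num, by
      rw [h, smul_smul, smul_smul]; norm_num⟩
  refine ⟨r / 2, fun i => ?_⟩
  have := congrFun hr i
  simp at this
  linarith

/-- A ray that is the zero set on `C` of a linear form nonnegative on `C` is extremal. -/
theorem mem_extremalVectors_of_linearMap {C : Set (Fin 3 → ℝ)} {v : Fin 3 → ℤ}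
    (φ : (Fin 3 → ℝ) →ₗ[ℝ] ℝ) (hprim : ∃ i, v i = 1)
    (hC : ∀ r : ℝ, 0 ≤ r → (r • fun i => (v i : ℝ)) ∈ C) (hφ : ∀ x ∈ C, 0 ≤ φ x)
    (hv : φ (fun i => (v i : ℝ)) = 0)
    (hray : ∀ x ∈ C, φ x = 0 → ∃ r : ℝ, 0 ≤ r ∧ x = r • fun i => (v i : ℝ)) :
    v ∈ extremalVectors C := by
  refine ⟨fun d hd => ?_, ⟨?_, ?_⟩⟩
  · obtain ⟨i, hi⟩ := hprim
    exact isUnit_of_dvd_one (hi ▸ hd i)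
  · rintro _ ⟨r, hr, rfl⟩
    exact hC r hr
  · rintro x hx y hy _ ⟨r, hr, rfl⟩ ⟨s, t, hs, ht, -, h⟩
    refine hray x hx ?_
    have h1 := congrArg φ h
    simp only [map_add, map_smul, hv, smul_eq_mul, mul_zero] at h1
    have h2 := mul_nonneg hs.le (hφ x hx)
    have h3 := mul_nonneg ht.le (hφ y hy)
    exact (mul_eq_zero.1 (by linarith : s * φ x = 0)).resolve_left hs.ne'

theorem powerCone_two_smul {n : ℕ} : ∀ x ∈ powerCone n, (2 : ℝ) • x ∈ powerCone n := by
  rintro x ⟨h, h'⟩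
  refine ⟨smul_nonneg zero_le_two h, ?_⟩
  simp only [Pi.smul_apply, smul_eq_mul]
  linarith

theorem productCone_two_smul {n : ℕ} : ∀ x ∈ productCone n, (2 : ℝ) • x ∈ productCone n := by
  rintro x ⟨h, h'⟩
  refine ⟨smul_nonneg zero_le_two h, ?_⟩
  simp only [Pi.smul_apply, smul_eq_mul]
  linarith

theorem vec_nonneg {x y z : ℝ} (hx : 0 ≤ x) (hy : 0 ≤ y) (hz : 0 ≤ z) :
    (0 : Fin 3 → ℝ) ≤ ![x, y, z] := by
  intro i
  fin_cases i <;> simpa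

theorem intVec_nonneg {v : Fin 3 → ℤ} (h : (0 : Fin 3 → ℝ) ≤ fun i => (v i : ℝ)) : 0 ≤ v := by
  intro i
  have := h i
  simpa using this

theorem fin_three_eq {α : Type*} {v : Fin 3 → α} {x y z : α} (hx : v 0 = x) (hy : v 1 = y)
    (hz : v 2 = z) : v = ![x, y, z] := by
  funext i
  fin_cases i <;> simpa

theorem coe_mem_of_mem_extremalVectors {C : Set (Fin 3 → ℝ)} {v : Fin 3 → ℤ}
    (hv : v ∈ extremalVectors C) : (fun i => (v i : ℝ)) ∈ C :=
  hv.2.subset ⟨1, zero_le_one, (one_smul ℝ _).symm⟩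

/-- Extremal vectors are primitive. -/
theorem eq_one_of_forall_dvd {v : Fin 3 → ℤ} {C : Set (Fin 3 → ℝ)} (hv : v ∈ extremalVectors C)
    {d : ℤ} (hd : 0 ≤ d) (h : ∀ i, d ∣ v i) : d = 1 :=
  (Int.isUnit_iff.1 (hv.1 d h)).resolve_right (by omega)

/-- The extremal vectors on the wall between the two maximal cones. -/
theorem eq_of_mem_extremalVectors_of_wall {n : ℕ} {C : Set (Fin 3 → ℝ)}
    (hC : ∀ x ∈ C, (2 : ℝ) • x ∈ C)
    (hwall : ∀ p q : ℝ, 0 ≤ p → 0 ≤ q → ![(n + 1) * p, (n + 1) * q, p + q] ∈ C)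
    {v : Fin 3 → ℤ} (hv : v ∈ extremalVectors C) (h0 : 0 ≤ v) (h : v 0 + v 1 = (n + 1) * v 2) :
    v = ![(n : ℤ) + 1, 0, 1] ∨ v = ![0, (n : ℤ) + 1, 1] := by
  have hn : (0 : ℝ) < n + 1 := by positivity
  have hp : (0 : ℝ) ≤ v 0 := by exact_mod_cast h0 0
  have hq : (0 : ℝ) ≤ v 1 := by exact_mod_cast h0 1
  have hR : (v 0 : ℝ) + v 1 = (n + 1) * v 2 := by exact_mod_cast h
  obtain ⟨c, hc⟩ := exists_eq_smul_of_mem_extremalVectors hC hv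
    (hwall (v 0 / (n + 1)) 0 (by positivity) le_rfl)
    (hwall 0 (v 1 / (n + 1)) le_rfl (by positivity)) (by
      funext i
      fin_cases i
      · simp; field_simp
      · simp; field_simp
      · simp; field_simp; linarith)
  have c0 : (v 0 : ℝ) = c * v 0 := by
    have := hc 0
    simp only [Matrix.cons_val] at this
    rwa [mul_div_cancel₀ _ hn.ne'] at this
  have c1 : (0 : ℝ) = c * v 1 := by simpa using hc 1
  by_cases hv0 : v 0 = 0
  · right
    have hv1 : v 1 = v 2 * (n + 1) := by linarith
    have hv2 : v 2 = 1 := eq_one_of_forall_dvd hv (h0 2) fun i => by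
      fin_cases i
      · simp [hv0]
      · exact Dvd.intro _ hv1.symm
      · exact dvd_rfl
    exact fin_three_eq hv0 (by rw [hv1, hv2, one_mul]) hv2
  · left
    have hc1 : c = 1 := by
      have : (v 0 : ℝ) ≠ 0 := by exact_mod_cast hv0
      exact mul_right_cancel₀ this (by linarith)
    have hv1 : v 1 = 0 := by
      rw [hc1, one_mul] at c1
      exact_mod_cast c1.symm
    have hv0' : v 0 = v 2 * (n + 1) := by linarith
    have hv2 : v 2 = 1 := eq_one_of_forall_dvd hv (h0 2) fun i => by
      fin_cases i
      · exact Dvd.intro _ hv0'.symm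
      · simp [hv1]
      · exact dvd_rfl
    exact fin_three_eq (by rw [hv0', hv2, one_mul]) hv1 hv2

theorem extremalVectors_powerCone_subset (n : ℕ) : extremalVectors (powerCone n) ⊆
    {![1, 0, 0], ![0, 1, 0], ![(n : ℤ) + 1, 0, 1], ![0, (n : ℤ) + 1, 1]} := by
  intro v hv
  obtain ⟨hnn, hle⟩ := coe_mem_of_mem_extremalVectors hv
  have h0 := intVec_nonneg hnn
  have hp : (0 : ℝ) ≤ v 0 := hnn 0
  have hq : (0 : ℝ) ≤ v 1 := hnn 1
  have hr : (0 : ℝ) ≤ v 2 := hnn 2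
  simp only at hle
  by_cases hv2 : v 2 = 0
  · have hv2R : (v 2 : ℝ) = 0 := by exact_mod_cast hv2
    obtain ⟨c, hc⟩ := exists_eq_smul_of_mem_extremalVectors powerCone_two_smul hv
      (x := ![(v 0 : ℝ), 0, 0]) (y := ![0, (v 1 : ℝ), 0])
      ⟨vec_nonneg hp le_rfl le_rfl, by simpa using hp⟩
      ⟨vec_nonneg le_rfl hq le_rfl, by simpa using hq⟩ (by
        funext i
        fin_cases i <;> simp [hv2])
    have c0 : (v 0 : ℝ) = c * v 0 := by simpa using hc 0
    have c1 : (0 : ℝ) = c * v 1 := by simpa using hc 1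
    by_cases hv0 : v 0 = 0
    · have hv1 : v 1 = 1 := eq_one_of_forall_dvd hv (h0 1) fun i => by
        fin_cases i
        · simp [hv0]
        · exact dvd_rfl
        · simp [hv2]
      exact Or.inr (Or.inl (fin_three_eq hv0 hv1 hv2))
    · have hc1 : c = 1 := by
        have : (v 0 : ℝ) ≠ 0 := by exact_mod_cast hv0
        exact mul_right_cancel₀ this (by linarith)
      have hv1 : v 1 = 0 := by
        rw [hc1, one_mul] at c1
        exact_mod_cast c1.symm
      have hv0' : v 0 = 1 := eq_one_of_forall_dvd hv (h0 0) fun i => by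
        fin_cases i
        · exact dvd_rfl
        · simp [hv1]
        · simp [hv2]
      exact Or.inl (fin_three_eq hv0' hv1 hv2)
  · have hr' : (0 : ℝ) < v 2 := lt_of_le_of_ne hr (by exact_mod_cast Ne.symm hv2)
    have hn : (0 : ℝ) < n + 1 := by positivity
    have hpos : (0 : ℝ) < v 0 + v 1 := lt_of_lt_of_le (by positivity) hle
    -- Scale the first two coordinates by `θ` to reach the wall.
    let θ : ℝ := (n + 1) * v 2 / (v 0 + v 1)
    have hθ : θ * (v 0 + v 1) = (n + 1) * v 2 := div_mul_cancel₀ _ hpos.ne'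
    have hθ1 : θ ≤ 1 := (div_le_one hpos).2 hle
    have hθ0 : 0 ≤ θ := by positivity
    have hx0 := mul_nonneg (sub_nonneg.2 hθ1) hp
    have hx1 := mul_nonneg (sub_nonneg.2 hθ1) hq
    obtain ⟨c, hc⟩ := exists_eq_smul_of_mem_extremalVectors powerCone_two_smul hv
      (x := ![(1 - θ) * v 0, (1 - θ) * v 1, 0]) (y := ![θ * v 0, θ * v 1, v 2])
      ⟨vec_nonneg hx0 hx1 le_rfl, by simpa using add_nonneg hx0 hx1⟩
      ⟨vec_nonneg (mul_nonneg hθ0 hp) (mul_nonneg hθ0 hq) hr, by simp; linarith⟩ (by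
        funext i
        fin_cases i
        · simp; ring
        · simp; ring
        · simp)
    have c2 : c = 0 := by
      have : (0 : ℝ) = c * v 2 := by simpa using hc 2
      exact (mul_eq_zero.1 this.symm).resolve_right hr'.ne'
    have e0 : (1 - θ) * v 0 = 0 := by simpa [c2] using hc 0
    have e1 : (1 - θ) * v 1 = 0 := by simpa [c2] using hc 1
    have hwall : (v 0 : ℝ) + v 1 = (n + 1) * v 2 := by linarith
    refine Or.inr (Or.inr (eq_of_mem_extremalVectors_of_wall powerCone_two_smul ?_ hv h0
      (by exact_mod_cast hwall)))
    intro p q hp hq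
    exact ⟨vec_nonneg (by positivity) (by positivity) (by positivity), by simp; linarith⟩

theorem extremalVectors_productCone_subset (n : ℕ) : extremalVectors (productCone n) ⊆
    {![0, 0, 1], ![(n : ℤ) + 1, 0, 1], ![0, (n : ℤ) + 1, 1]} := by
  intro v hv
  obtain ⟨hnn, hle⟩ := coe_mem_of_mem_extremalVectors hv
  have h0 := intVec_nonneg hnn
  have hp : (0 : ℝ) ≤ v 0 := hnn 0
  have hq : (0 : ℝ) ≤ v 1 := hnn 1
  have hn : (0 : ℝ) < n + 1 := by positivity
  simp only at hle
  by_cases h01 : v 0 = 0 ∧ v 1 = 0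
  · have hv2 : v 2 = 1 := eq_one_of_forall_dvd hv (h0 2) fun i => by
      fin_cases i
      · simp [h01.1]
      · simp [h01.2]
      · exact dvd_rfl
    exact Or.inl (fin_three_eq h01.1 h01.2 hv2)
  · have hdiv : (n + 1) * (((v 0 : ℝ) + v 1) / (n + 1)) = v 0 + v 1 := mul_div_cancel₀ _ hn.ne'
    have hz : 0 ≤ (v 2 : ℝ) - (v 0 + v 1) / (n + 1) := by
      rw [sub_nonneg, div_le_iff₀ hn]
      linarith
    obtain ⟨c, hc⟩ := exists_eq_smul_of_mem_extremalVectors productCone_two_smul hv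
      (x := ![0, 0, v 2 - (v 0 + v 1) / (n + 1)]) (y := ![v 0, v 1, (v 0 + v 1) / (n + 1)])
      ⟨vec_nonneg le_rfl le_rfl hz, by simpa using mul_nonneg hn.le hz⟩
      ⟨vec_nonneg hp hq (by positivity), by simp [hdiv]⟩ (by
        funext i
        fin_cases i <;> simp)
    have c0 : (0 : ℝ) = c * v 0 := by simpa using hc 0
    have c1 : (0 : ℝ) = c * v 1 := by simpa using hc 1
    have hc0 : c = 0 := by
      by_contra hne
      refine h01 ⟨?_, ?_⟩
      · exact_mod_cast (mul_eq_zero.1 c0.symm).resolve_left hne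
      · exact_mod_cast (mul_eq_zero.1 c1.symm).resolve_left hne
    have e2 : (v 2 : ℝ) - (v 0 + v 1) / (n + 1) = 0 := by simpa [hc0] using hc 2
    have hwall : (v 0 : ℝ) + v 1 = (n + 1) * v 2 := by
      rw [← hdiv, ← sub_eq_zero.1 e2]
    refine Or.inr (eq_of_mem_extremalVectors_of_wall productCone_two_smul ?_ hv h0
      (by exact_mod_cast hwall))
    intro p q hp hq
    exact ⟨vec_nonneg (by positivity) (by positivity) (by positivity), by simp; linarith⟩

theorem mem_extremalVectors_powerCone (n : ℕ) :
    ![1, 0, 0] ∈ extremalVectors (powerCone n) ∧ ![0, 1, 0] ∈ extremalVectors (powerCone n) := by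
  have hn : (0 : ℝ) < n + 1 := by positivity
  let e (i : Fin 3) : (Fin 3 → ℝ) →ₗ[ℝ] ℝ := LinearMap.proj i
  refine ⟨mem_extremalVectors_of_linearMap (e 1 + e 2) ⟨0, rfl⟩ ?_ ?_ (by simp [e]) ?_,
    mem_extremalVectors_of_linearMap (e 0 + e 2) ⟨1, rfl⟩ ?_ ?_ (by simp [e]) ?_⟩
  · exact fun r hr => ⟨smul_nonneg hr (by intro i; fin_cases i <;> simp), by simpa using hr⟩
  · exact fun x hx => add_nonneg (hx.1 1) (hx.1 2)
  · intro x hx h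
    have h0 : 0 ≤ x 0 := hx.1 0
    have h1 : 0 ≤ x 1 := hx.1 1
    have h2 : 0 ≤ x 2 := hx.1 2
    have h : x 1 + x 2 = 0 := h
    refine ⟨x 0, h0, ?_⟩
    funext i
    fin_cases i <;> simp <;> linarith
  · exact fun r hr => ⟨smul_nonneg hr (by intro i; fin_cases i <;> simp), by simpa using hr⟩
  · exact fun x hx => add_nonneg (hx.1 0) (hx.1 2)
  · intro x hx h
    have h0 : 0 ≤ x 0 := hx.1 0
    have h1 : 0 ≤ x 1 := hx.1 1
    have h2 : 0 ≤ x 2 := hx.1 2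
    have h : x 0 + x 2 = 0 := h
    refine ⟨x 1, h1, ?_⟩
    funext i
    fin_cases i <;> simp <;> linarith

theorem mem_extremalVectors_productCone (n : ℕ) :
    ![0, 0, 1] ∈ extremalVectors (productCone n) ∧
      ![(n : ℤ) + 1, 0, 1] ∈ extremalVectors (productCone n) ∧
      ![0, (n : ℤ) + 1, 1] ∈ extremalVectors (productCone n) := by
  have hn : (0 : ℝ) < n + 1 := by positivity
  let e (i : Fin 3) : (Fin 3 → ℝ) →ₗ[ℝ] ℝ := LinearMap.proj i
  refine ⟨mem_extremalVectors_of_linearMap (e 0 + e 1) ⟨2, rfl⟩ ?_ ?_ (by simp [e]) ?_,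
    mem_extremalVectors_of_linearMap ((n + 1 : ℝ) • e 2 - e 0) ⟨2, rfl⟩ ?_ ?_ (by simp [e]) ?_,
    mem_extremalVectors_of_linearMap ((n + 1 : ℝ) • e 2 - e 1) ⟨2, rfl⟩ ?_ ?_ (by simp [e]) ?_⟩
  · exact fun r hr => ⟨smul_nonneg hr (by intro i; fin_cases i <;> simp), by
      simpa using mul_nonneg hn.le hr⟩
  · exact fun x hx => add_nonneg (hx.1 0) (hx.1 1)
  · intro x hx h
    have h0 : 0 ≤ x 0 := hx.1 0
    have h1 : 0 ≤ x 1 := hx.1 1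
    have h : x 0 + x 1 = 0 := h
    refine ⟨x 2, hx.1 2, ?_⟩
    funext i
    fin_cases i <;> simp <;> linarith
  · exact fun r hr => ⟨smul_nonneg hr (by intro i; fin_cases i <;> simp; positivity), by
      simp; linarith⟩
  · intro x hx
    have h1 : 0 ≤ x 1 := hx.1 1
    have h2 := hx.2
    have : 0 ≤ (n + 1) * x 2 - x 0 := by linarith
    exact this
  · intro x hx h
    have h1 : 0 ≤ x 1 := hx.1 1
    have h2 := hx.2
    have h : (n + 1) * x 2 - x 0 = 0 := h
    refine ⟨x 2, hx.1 2, ?_⟩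
    funext i
    fin_cases i <;> simp <;> linarith
  · exact fun r hr => ⟨smul_nonneg hr (by intro i; fin_cases i <;> simp; positivity), by
      simp; linarith⟩
  · intro x hx
    have h0 : 0 ≤ x 0 := hx.1 0
    have h2 := hx.2
    have : 0 ≤ (n + 1) * x 2 - x 1 := by linarith
    exact this
  · intro x hx h
    have h0 : 0 ≤ x 0 := hx.1 0
    have h2 := hx.2
    have h : (n + 1) * x 2 - x 1 = 0 := h
    refine ⟨x 2, hx.1 2, ?_⟩
    funext i
    fin_cases i <;> simp <;> linarith

theorem coneProfile_powerCone_subset (n : ℕ) :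
    coneProfile (powerCone n) ⊆ {w | 0 ≤ w ∧ w 2 ≤ 1 ∧ w 0 + w 1 = 1 + n * w 2} := by
  refine convexHull_min ?_ ?_
  · rintro _ ⟨v, hv, rfl⟩
    rcases extremalVectors_powerCone_subset n hv with rfl | rfl | rfl | rfl
    · exact ⟨by intro i; fin_cases i <;> simp, by simp, by simp⟩
    · exact ⟨by intro i; fin_cases i <;> simp, by simp, by simp⟩
    · exact ⟨by intro i; fin_cases i <;> simp; positivity, by simp, by simp; ring⟩
    · exact ⟨by intro i; fin_cases i <;> simp; positivity, by simp, by simp; ring⟩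
  · rintro x ⟨hx, hx2, hx01⟩ y ⟨hy, hy2, hy01⟩ s t hs ht hst
    refine ⟨add_nonneg (smul_nonneg hs hx) (smul_nonneg ht hy), ?_, ?_⟩
    · simp only [Pi.add_apply, Pi.smul_apply, smul_eq_mul]
      nlinarith
    · simp only [Pi.add_apply, Pi.smul_apply, smul_eq_mul]
      linear_combination s * hx01 + t * hy01 + hst

theorem coneProfile_productCone_subset (n : ℕ) :
    coneProfile (productCone n) ⊆ {w | 0 ≤ w ∧ w 2 = 1 ∧ w 0 + w 1 ≤ n + 1} := by
  refine convexHull_min ?_ ?_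
  · rintro _ ⟨v, hv, rfl⟩
    rcases extremalVectors_productCone_subset n hv with rfl | rfl | rfl
    · exact ⟨by intro i; fin_cases i <;> simp, by simp, by simp; positivity⟩
    · exact ⟨by intro i; fin_cases i <;> simp; positivity, by simp, by simp⟩
    · exact ⟨by intro i; fin_cases i <;> simp; positivity, by simp, by simp⟩
  · rintro x ⟨hx, hx2, hx01⟩ y ⟨hy, hy2, hy01⟩ s t hs ht hst
    refine ⟨add_nonneg (smul_nonneg hs hx) (smul_nonneg ht hy), ?_, ?_⟩
    · simp only [Pi.add_apply, Pi.smul_apply, smul_eq_mul]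
      rw [hx2, hy2, mul_one, mul_one, hst]
    · simp only [Pi.add_apply, Pi.smul_apply, smul_eq_mul]
      have h1 := mul_le_mul_of_nonneg_left hx01 hs
      have h2 := mul_le_mul_of_nonneg_left hy01 ht
      have h3 : s * (n + 1) + t * (n + 1) = n + 1 := by rw [← add_mul, hst, one_mul]
      linarith

theorem mem_profileLatticePoints_singularityA {n : ℕ} {v : Fin 3 → ℤ} :
    v ∈ profileLatticePoints (singularityA n) ↔ v = ![1, 0, 0] ∨ v = ![0, 1, 0] ∨
      ∃ a b : ℕ, a + b ≤ n + 1 ∧ v = ![(a : ℤ), (b : ℤ), 1] := by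
  have hn : (0 : ℝ) < n + 1 := by positivity
  simp only [profileLatticePoints, maximalGroebnerCones_singularityA, Set.mem_insert_iff,
    Set.mem_singleton_iff, exists_eq_or_imp, exists_eq_left, Set.mem_ofPred_eq]
  constructor
  · have hnat (hv : 0 ≤ v) (h2 : v 2 = 1) (h01 : v 0 + v 1 ≤ n + 1) :
        ∃ a b : ℕ, a + b ≤ n + 1 ∧ v = ![(a : ℤ), (b : ℤ), 1] := by
      have h0 : 0 ≤ v 0 := hv 0
      have h1 : 0 ≤ v 1 := hv 1
      exact ⟨(v 0).toNat, (v 1).toNat, by omega,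
        fin_three_eq (Int.toNat_of_nonneg h0).symm (Int.toNat_of_nonneg h1).symm h2⟩
    rintro (h | h)
    · obtain ⟨hv, h2, h01⟩ := coneProfile_powerCone_subset n h
      beta_reduce at h2 h01
      replace hv := intVec_nonneg hv
      have h0 : 0 ≤ v 0 := hv 0
      have h1 : 0 ≤ v 1 := hv 1
      have h2' : 0 ≤ v 2 := hv 2
      have h2 : v 2 ≤ 1 := by exact_mod_cast h2
      have h01 : v 0 + v 1 = 1 + n * v 2 := by exact_mod_cast h01
      obtain hz | hz : v 2 = 0 ∨ v 2 = 1 := by omega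
      · rw [hz, mul_zero, add_zero] at h01
        obtain hx | hx : v 0 = 0 ∨ v 0 = 1 := by omega
        · exact Or.inr (Or.inl (fin_three_eq hx (by omega) hz))
        · exact Or.inl (fin_three_eq hx (by omega) hz)
      · rw [hz, mul_one] at h01
        exact Or.inr (Or.inr (hnat hv hz (by omega)))
    · obtain ⟨hv, h2, h01⟩ := coneProfile_productCone_subset n h
      beta_reduce at h2 h01
      exact Or.inr (Or.inr (hnat (intVec_nonneg hv) (by exact_mod_cast h2)
        (by exact_mod_cast h01)))
  · rintro (rfl | rfl | ⟨a, b, hab, rfl⟩)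
    · exact Or.inl (subset_convexHull ℝ _ ⟨_, (mem_extremalVectors_powerCone n).1, rfl⟩)
    · exact Or.inl (subset_convexHull ℝ _ ⟨_, (mem_extremalVectors_powerCone n).2, rfl⟩)
    · right
      obtain ⟨m1, m2, m3⟩ := mem_extremalVectors_productCone n
      have hab' : (a : ℝ) + b ≤ n + 1 := by exact_mod_cast hab
      have hconv := convex_convexHull ℝ
        ((fun v : Fin 3 → ℤ => fun i => (v i : ℝ)) '' extremalVectors (productCone n))
      have := hconv.sum_mem (t := Finset.univ)
        (w := ![1 - (a : ℝ) / (n + 1) - b / (n + 1), (a : ℝ) / (n + 1), (b : ℝ) / (n + 1)])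
        (z := fun k i => ((![![0, 0, 1], ![(n : ℤ) + 1, 0, 1], ![0, (n : ℤ) + 1, 1]] k i : ℤ) : ℝ))
        (by
          intro k _
          refine vec_nonneg ?_ (by positivity) (by positivity) k
          rw [sub_sub, ← add_div, sub_nonneg]
          exact (div_le_one hn).2 hab')
        (by simp [Fin.sum_univ_three]; ring)
        (by
          intro k _
          refine subset_convexHull ℝ _ ⟨_, ?_, rfl⟩
          fin_cases k
          exacts [m1, m2, m3])
      refine Eq.mp (congrArg (· ∈ _) ?_) this
      funext i
      fin_cases i
      · simp [Fin.sum_univ_three]; field_simp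
      · simp [Fin.sum_univ_three]; field_simp
      · simp [Fin.sum_univ_three]; ring

end Fan

/-! ### Profiles and embedded valuations -/

theorem mainTheorem7 (n : ℕ) :
    (monomialValuation '' profileLatticePoints (singularityA n) =
      embeddedValuations (singularityA n) (coordHyperplanesIdeal (Fin 3)) ∪
        Set.range (fun i : Fin 3 => monomialValuation (Pi.single i (1 : ℤ)))) ∧
    (monomialValuation '' {v ∈ profileLatticePoints (singularityA n) | ∀ i, 0 < v i} =
      embeddedValuations (singularityA n) (singularIdeal (singularityA n))) := by
  have s0 : (Pi.single 0 1 : Fin 3 → ℤ) = ![1, 0, 0] := fin_three_eq rfl rfl rfl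
  have s1 : (Pi.single 1 1 : Fin 3 → ℤ) = ![0, 1, 0] := fin_three_eq rfl rfl rfl
  have s2 : (Pi.single 2 1 : Fin 3 → ℤ) = ![0, 0, 1] := fin_three_eq rfl rfl rfl
  constructor
  · rw [(isStandardBase_coordHyperplanes n).embeddedValuations_eq (Or.inl rfl)]
    ext ν
    constructor
    · rintro ⟨v, hv, rfl⟩
      rcases mem_profileLatticePoints_singularityA.1 hv with rfl | rfl | ⟨a, b, hab, rfl⟩
      · exact Or.inr ⟨0, by simp only [s0]⟩
      · exact Or.inr ⟨1, by simp only [s1]⟩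
      · rcases Nat.eq_zero_or_pos (a + b) with h | h
        · obtain ⟨rfl, rfl⟩ : a = 0 ∧ b = 0 := by omega
          exact Or.inr ⟨2, by simp only [s2]; rfl⟩
        · exact Or.inl ⟨a, b, Nat.zero_le _, Nat.zero_le _, h, hab, rfl⟩
    · rintro (⟨a, b, -, -, -, hab, rfl⟩ | ⟨i, rfl⟩)
      · exact ⟨_, mem_profileLatticePoints_singularityA.2 (Or.inr (Or.inr ⟨a, b, hab, rfl⟩)), rfl⟩
      · refine ⟨_, mem_profileLatticePoints_singularityA.2 ?_, rfl⟩
        fin_cases i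
        · exact Or.inl s0
        · exact Or.inr (Or.inl s1)
        · exact Or.inr (Or.inr ⟨0, 0, by omega, s2⟩)
  · have hpos (ν : MvPolynomial (Fin 3) ℂ → ℕ∞) :
        ν ∈ monomialValuation '' {v ∈ profileLatticePoints (singularityA n) | ∀ i, 0 < v i} ↔
          ∃ a b : ℕ, 1 ≤ a ∧ 1 ≤ b ∧ 1 ≤ a + b ∧ a + b ≤ n + 1 ∧
            ν = monomialValuation ![(a : ℤ), (b : ℤ), 1] := by
      constructor
      · rintro ⟨v, ⟨hv, hpos⟩, rfl⟩
        rcases mem_profileLatticePoints_singularityA.1 hv with rfl | rfl | ⟨a, b, hab, rfl⟩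
        · exact absurd (hpos 1) (by simp)
        · exact absurd (hpos 0) (by simp)
        · have ha : 0 < (a : ℤ) := hpos 0
          have hb : 0 < (b : ℤ) := hpos 1
          exact ⟨a, b, by omega, by omega, by omega, hab, rfl⟩
      · rintro ⟨a, b, ha, hb, -, hab, rfl⟩
        refine ⟨_, ⟨mem_profileLatticePoints_singularityA.2 (Or.inr (Or.inr ⟨a, b, hab, rfl⟩)),
          fun i => ?_⟩, rfl⟩
        fin_cases i <;> simp <;> omega
    ext ν
    rw [hpos]
    rcases Nat.eq_zero_or_pos n with rfl | hn
    · rw [embeddedValuations_singularIdeal_zero]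
      refine iff_of_false ?_ (Set.notMem_empty ν)
      rintro ⟨a, b, ha, hb, -, hab, -⟩
      omega
    · rw [(isStandardBase_singularIdeal hn).embeddedValuations_eq (Or.inr ⟨rfl, hn⟩)]
      rfl
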